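/- Let $(K,d)$ be a metric space in which sets of finite diameter are relatively compact, let $(V,E,i,t)$ be a finite directed multigraph with $V=\{1,\dots,N\}$ and $i:E\to V$ surjective, and let $\mathcal M=(K_{i(e)},w_e,p_e)_{e\in E}$ be a contractive Markov system on $K$: $K_1,\dots,K_N$ is a partition of $K$ into non-empty open sets; the maps $w_e:K\to K$ are Borel with $w_e(K_{i(e)})\subset K_{t(e)}$; the functions $p_e:K\to[0,\infty)$ are Borel with $\sum_{e\in E}p_e=1$ and $p_e=0$ off $K_{i(e)}$; and there is $0<a<1$ with $\sum_{e\in E}p_e(x)\,d(w_ex,w_ey)\le a\,d(x,y)$ for all $x,y\in K_j$, $j=1,\dots,N$. Assume that each $p_e|_{K_{i(e)}}$ is uniformly continuous and that $p_e|_{K_{i(e)}}\ge\delta$ for some $\delta>0$ independent of $e$. Let $\mu$ be an invariant Borel probability measure, i.e. $\int\sum_{e}p_e\,(f\circ w_e)\,d\mu=\int f\,d\mu$ for all bounded Borel $f:K\to\mathbb R$, and let $M$ be the associated generalized Markov measure, i.e. the Borel probability measure on $\Sigma=E^{\mathbb Z}$ with \[M\left(\{\sigma:\sigma_m=e_1,\dots,\sigma_{m+k-1}=e_k\}\right)=\int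 p_{e_1}(x)\,p_{e_2}(w_{e_1}x)\cdots p_{e_k}(w_{e_{k-1}}\circ\cdots\circ w_{e_1}x)\,d\mu(x)\] for all $m\in\mathbb Z$, $k\ge1$ and $e_1,\dots,e_k\in E$. Let $S$ be the left shift on $\Sigma$. Fix $x_j\in K_j$ for $j=1,\dots,N$. Let $D$ be the set of all $\sigma\in\Sigma$ with $t(\sigma_j)=i(\sigma_{j+1})$ for all $j\in\mathbb Z$ for which the limit $F(\sigma)=\lim_{m\to-\infty}w_{\sigma_0}\circ w_{\sigma_{-1}}\circ\cdots\circ w_{\sigma_m}x_{i(\sigma_m)}$ exists. Put $Y=\bigcap_{k\in\mathbb Z}S^k(D)$, and let $u(\sigma)=\log p_{\sigma_1}(F(\sigma))$ for $\sigma\in Y$ and $u(\sigma)=-\infty$ for $\sigma\in\Sigma\setminus Y$. Suppose that $\sum_{j=1}^N\int_{K_j}d(x,z_j)\,d\mu(x)<\infty$ for some $z_1,\dots,z_N\in K$, and that $M(Y)=1$. Then: (i) $M$ is an equilibrium state for $u$; that is, $u$ is a Borel function with values in $[-\infty,0]$, $\sup_\Theta h_\Theta(S)<\infty$, $M$ is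 $S$-invariant, and $h_M(S)+\int u\,dM=P(u)$, where $P(u)=\sup_\Theta\left(h_\Theta(S)+\int u\,d\Theta\right)$, both suprema are over all $S$-invariant Borel probability measures $\Theta$ on $\Sigma$, and $h_\Theta(S)$ is the Kolmogorov-Sinai entropy; (ii) $P(u)=0$. -/

import Mathlib

open MeasureTheory Filter Topology


noncomputable section

/-! ### Entropy, pressure, equilibrium states -/

section Thermodynamics

variable {X : Type*} [MeasurableSpace X]

/-- Shannon entropy of the join `⋁_{i<n} T⁻ⁱ P`, where the finite measurable partition `P` of `X`
into (possibly empty) cells is given by its labelling map `P : X → Fin k`. -/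
def joinEntropy (T : X → X) (Θ : Measure X) {k : ℕ} (P : X → Fin k) (n : ℕ) : ℝ :=
  ∑ c : Fin n → Fin k, Real.negMulLog (Θ.real {x | ∀ i : Fin n, P (T^[i] x) = c i})

/-- Entropy of `T` relative to a finite partition: `lim (1/n) H(⋁_{i<n} T⁻ⁱ P)`.
For invariant `Θ` the limit exists by subadditivity, so it is equal to the upper limit. -/
def partitionEntropy (T : X → X) (Θ : Measure X) {k : ℕ} (P : X → Fin k) : EReal :=
  limsup (fun n : ℕ => ((joinEntropy T Θ P n / n : ℝ) : EReal)) atTop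

/-- Kolmogorov-Sinai entropy: the supremum over all finite measurable partitions. -/
def ksEntropy (T : X → X) (Θ : Measure X) : EReal :=
  ⨆ (k : ℕ) (P : X → Fin k) (_ : Measurable P), partitionEntropy T Θ P

/-- Invariant probability measures of `T`. -/
def invariantMeasures (T : X → X) : Set (Measure X) :=
  {Θ | IsProbabilityMeasure Θ ∧ MeasurePreserving T Θ Θ}

/-- An energy function is a measurable function with values in `[-∞, 0]`. -/
structure IsEnergyFunction (f : X → EReal) : Prop where
  measurable : Measurable f
  nonpos : ∀ x, f x ≤ 0

/-- The integral `Θ(f) ∈ [-∞, 0]` of a function `f` with values in `[-∞, 0]`. -/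
def energyIntegral (Θ : Measure X) (f : X → EReal) : EReal :=
  -((∫⁻ x, (-f x).toENNReal ∂Θ : ENNReal) : EReal)

/-- `T` has finite topological entropy, in the variational form `sup_Θ h_Θ(T) < ∞`. -/
def HasFiniteEntropy (T : X → X) : Prop :=
  (⨆ Θ ∈ invariantMeasures T, ksEntropy T Θ) < ⊤

/-- The pressure `P(f) = sup_Θ (h_Θ(T) + Θ(f))` over the invariant probability measures. -/
def pressure (T : X → X) (f : X → EReal) : EReal :=
  ⨆ Θ ∈ invariantMeasures T, (ksEntropy T Θ + energyIntegral Θ f)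

/-- `Λ` is an equilibrium state for `f`. The first two fields are what the definition of the
pressure presupposes. -/
structure IsEquilibriumState (T : X → X) (f : X → EReal) (Λ : Measure X) : Prop where
  energy : IsEnergyFunction f
  finite_entropy : HasFiniteEntropy T
  invariant : Λ ∈ invariantMeasures T
  attains : ksEntropy T Λ + energyIntegral Λ f = pressure T f

end Thermodynamics

/-! ### Markov systems -/

/-- A Markov system on `K` over the finite directed multigraph with vertices `V`, edges `E`,
initial-vertex map `init` and terminal-vertex map `term`. -/
structure MarkovSystem (V E K : Type*) [Fintype E] [MeasurableSpace K] where
  init : E → V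
  term : E → V
  vertexSet : V → Set K
  w : E → K → K
  p : E → K → ℝ
  vertexSet_nonempty : ∀ v, (vertexSet v).Nonempty
  vertexSet_measurable : ∀ v, MeasurableSet (vertexSet v)
  vertexSet_disjoint : Pairwise fun v v' => Disjoint (vertexSet v) (vertexSet v')
  vertexSet_cover : ⋃ v, vertexSet v = Set.univ
  w_measurable : ∀ e, Measurable (w e)
  w_mapsTo : ∀ e, Set.MapsTo (w e) (vertexSet (init e)) (vertexSet (term e))
  p_measurable : ∀ e, Measurable (p e)
  p_nonneg : ∀ e x, 0 ≤ p e x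
  p_sum : ∀ x, ∑ e, p e x = 1
  p_zero : ∀ e, ∀ x ∉ vertexSet (init e), p e x = 0

/-- The code space `E^ℤ`, with the product topology and its Borel σ-algebra. -/
abbrev CodeSpace (E : Type*) := ℤ → E

/-- The left shift. -/
def leftShift {E : Type*} (σ : CodeSpace E) : CodeSpace E := fun j => σ (j + 1)

/-- The cylinder `ₘ[e₁, …, e_k] = {σ | σ_m = e₁, …, σ_{m+k-1} = e_k}`. -/
def cylinderSet {E : Type*} (m : ℤ) (l : List E) : Set (CodeSpace E) :=
  {σ | ∀ j : Fin l.length, σ (m + (j : ℕ)) = l.get j}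

namespace MarkovSystem

variable {V E K : Type*} [Fintype E] [MeasurableSpace K]

/-- Contractiveness on average with rate `a`. -/
def IsContractive [PseudoMetricSpace K] (S : MarkovSystem V E K) (a : ℝ) : Prop :=
  0 < a ∧ a < 1 ∧ ∀ v, ∀ x ∈ S.vertexSet v, ∀ y ∈ S.vertexSet v,
    ∑ e, S.p e x * dist (S.w e x) (S.w e y) ≤ a * dist x y

/-- The Markov operator `U f = ∑ₑ pₑ · (f ∘ wₑ)`. -/
def markovOp (S : MarkovSystem V E K) (f : K → ℝ) (x : K) : ℝ :=
  ∑ e, S.p e x * f (S.w e x)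

/-- Invariance `U* μ = μ`, tested on all bounded measurable functions. -/
def IsInvariant (S : MarkovSystem V E K) (μ : Measure K) : Prop :=
  ∀ f : K → ℝ, Measurable f → (∃ C, ∀ x, |f x| ≤ C) →
    ∫ x, S.markovOp f x ∂μ = ∫ x, f x ∂μ

/-- `p_{e₁}(x) p_{e₂}(w_{e₁} x) ⋯ p_{e_k}(w_{e_{k-1}} ∘ ⋯ ∘ w_{e₁} x)`. -/
def pathProb (S : MarkovSystem V E K) : List E → K → ℝ
  | [], _ => 1
  | e :: l, x => S.p e x * S.pathProb l (S.w e x)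

/-- `M` has the cylinder values that define the generalized Markov measure. -/
def HasMarkovCylinders [MeasurableSpace E] (S : MarkovSystem V E K) (μ : Measure K)
    (M : Measure (CodeSpace E)) : Prop :=
  ∀ (m : ℤ) (l : List E), M (cylinderSet m l) = ENNReal.ofReal (∫ x, S.pathProb l x ∂μ)

/-! Existence and uniqueness of the measure with these cylinder values. -/

lemma pathProb_measurable (S : MarkovSystem V E K) (l : List E) : Measurable (S.pathProb l) := by
  induction l with
  | nil => exact measurable_const
  | cons e l ih => exact (S.p_measurable e).mul (ih.comp (S.w_measurable e))

lemma p_le_one (S : MarkovSystem V E K) (e : E) (x : K) : S.p e x ≤ 1 := by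
  rw [← S.p_sum x]
  exact Finset.single_le_sum (fun i _ => S.p_nonneg i x) (Finset.mem_univ e)

lemma pathProb_mem (S : MarkovSystem V E K) (l : List E) (x : K) :
    0 ≤ S.pathProb l x ∧ S.pathProb l x ≤ 1 := by
  induction l generalizing x with
  | nil => simp [pathProb]
  | cons e l ih =>
    have h := ih (S.w e x)
    exact ⟨mul_nonneg (S.p_nonneg e x) h.1, mul_le_one₀ (S.p_le_one e x) h.1 h.2⟩

lemma pathProb_integrable (S : MarkovSystem V E K) (μ : Measure K) [IsProbabilityMeasure μ]
    (l : List E) : Integrable (S.pathProb l) μ :=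
  Integrable.of_bound (S.pathProb_measurable l).aestronglyMeasurable 1
    (Eventually.of_forall fun x => by
      rw [Real.norm_eq_abs, abs_of_nonneg (S.pathProb_mem l x).1]; exact (S.pathProb_mem l x).2)

lemma sum_pathProb_append (S : MarkovSystem V E K) (l : List E) (x : K) :
    ∑ e, S.pathProb (l ++ [e]) x = S.pathProb l x := by
  induction l generalizing x with
  | nil => simpa [pathProb] using S.p_sum x
  | cons e l ih => simp only [List.cons_append, pathProb, ← Finset.mul_sum, ih]

lemma sum_integral_append (S : MarkovSystem V E K) (μ : Measure K) [IsProbabilityMeasure μ]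
    (l : List E) : ∑ e, ∫ x, S.pathProb (l ++ [e]) x ∂μ = ∫ x, S.pathProb l x ∂μ := by
  rw [← integral_finsetSum _ fun e _ => S.pathProb_integrable μ _]
  simp only [sum_pathProb_append]

lemma sum_integral_cons (S : MarkovSystem V E K) (μ : Measure K) [IsProbabilityMeasure μ]
    (hμ : S.IsInvariant μ) (l : List E) :
    ∑ e, ∫ x, S.pathProb (e :: l) x ∂μ = ∫ x, S.pathProb l x ∂μ := by
  rw [← integral_finsetSum _ fun e _ => S.pathProb_integrable μ _]
  exact hμ _ (S.pathProb_measurable l) ⟨1, fun x => by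
    rw [abs_of_nonneg (S.pathProb_mem l x).1]; exact (S.pathProb_mem l x).2⟩

lemma cylinder_cons (m : ℤ) (e : E) (l : List E) :
    cylinderSet m (e :: l) = {σ : CodeSpace E | σ m = e} ∩ cylinderSet (m + 1) l := by
  ext σ
  simp only [cylinderSet, Set.mem_ofPred_eq, Set.mem_inter_iff]
  constructor
  · intro h
    refine ⟨by simpa using h ⟨0, by simp⟩, fun j => ?_⟩
    have := h ⟨j + 1, by simp⟩
    simp only [List.get_eq_getElem, List.getElem_cons_succ] at this ⊢
    rw [← this]; congr 1; push_cast; ring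
  · rintro ⟨h0, h⟩ ⟨j, hj⟩
    cases j with
    | zero => simpa using h0
    | succ j =>
      have := h ⟨j, by simpa using hj⟩
      simp only [List.get_eq_getElem, List.getElem_cons_succ] at this ⊢
      rw [← this]; congr 1; push_cast; ring

lemma cylinder_append (m : ℤ) (l : List E) (e : E) :
    cylinderSet m (l ++ [e]) = cylinderSet m l ∩ {σ : CodeSpace E | σ (m + l.length) = e} := by
  induction l generalizing m with
  | nil => simp [cylinderSet]
  | cons f l ih =>
    rw [List.cons_append, cylinder_cons, ih, cylinder_cons, Set.inter_assoc]
    congr 2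
    ext σ
    simp only [List.length_cons, Set.mem_ofPred_eq]
    rw [show m + ((l.length + 1 : ℕ) : ℤ) = m + 1 + l.length by push_cast; ring]

section Existence

variable [TopologicalSpace E] [DiscreteTopology E] [MeasurableSpace E] [BorelSpace E]

lemma cylinder_isClopen (m : ℤ) (l : List E) : IsClopen (cylinderSet m l) := by
  have : cylinderSet m l = ⋂ j : Fin l.length,
      (fun σ : CodeSpace E => σ (m + (j : ℕ))) ⁻¹' {l.get j} := by
    ext σ; simp [cylinderSet]
  rw [this]
  exact isClopen_iInter_of_finite fun j => (isClopen_discrete _).preimage (continuous_apply _)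

lemma measurableSet_coord (j : ℤ) (e : E) : MeasurableSet {σ : CodeSpace E | σ j = e} := by
  have h : MeasurableSet ((fun σ : CodeSpace E => σ j) ⁻¹' {e}) :=
    measurable_pi_apply j (measurableSet_singleton e)
  exact h

lemma measure_eq_sum_inter (M : Measure (CodeSpace E)) (A : Set (CodeSpace E))
    (hA : MeasurableSet A) (j : ℤ) : M A = ∑ e, M (A ∩ {σ | σ j = e}) := by
  rw [← measure_biUnion_finset]
  · congr 1; ext σ; simp
  · intro e _ e' _ hne
    refine Set.disjoint_left.2 fun σ h h' => hne ?_
    exact h.2.symm.trans h'.2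
  · exact fun e _ => hA.inter (measurableSet_coord j e)

lemma measure_cylinder_append (M : Measure (CodeSpace E)) (m : ℤ) (l : List E) :
    M (cylinderSet m l) = ∑ e, M (cylinderSet m (l ++ [e])) := by
  simp only [cylinder_append]
  exact measure_eq_sum_inter M _ (cylinder_isClopen m l).isOpen.measurableSet _

lemma measure_cylinder_cons (M : Measure (CodeSpace E)) (m : ℤ) (l : List E) :
    M (cylinderSet (m + 1) l) = ∑ e, M (cylinderSet m (e :: l)) := by
  simp only [cylinder_cons, Set.inter_comm _ (cylinderSet (m + 1) l)]
  exact measure_eq_sum_inter M _ (cylinder_isClopen _ l).isOpen.measurableSet _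

lemma hasCylinders_of_window (S : MarkovSystem V E K) (μ : Measure K) [IsProbabilityMeasure μ]
    (hμ : S.IsInvariant μ) (M : Measure (CodeSpace E)) (m : ℤ) (L : ℕ)
    (h : ∀ l : List E, l.length = L →
      M (cylinderSet m l) = ENNReal.ofReal (∫ x, S.pathProb l x ∂μ)) (i : ℕ) :
    ∀ (d : ℕ) (l : List E), i + l.length + d = L →
      M (cylinderSet (m + i) l) = ENNReal.ofReal (∫ x, S.pathProb l x ∂μ) := by
  have hnn : ∀ l : List E, 0 ≤ ∫ x, S.pathProb l x ∂μ := fun l =>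
    integral_nonneg fun x => (S.pathProb_mem l x).1
  induction i with
  | zero =>
    intro d
    induction d with
    | zero => intro l hl; simpa using h l (by simpa using hl)
    | succ d ih =>
      intro l hl
      rw [measure_cylinder_append, ← S.sum_integral_append μ l,
        ENNReal.ofReal_sum_of_nonneg fun e _ => hnn _]
      exact Finset.sum_congr rfl fun e _ => ih _ (by simp; omega)
  | succ i ih =>
    intro d l hl
    rw [show m + ((i + 1 : ℕ) : ℤ) = (m + i) + 1 by push_cast; ring, measure_cylinder_cons,
      ← S.sum_integral_cons μ hμ l, ENNReal.ofReal_sum_of_nonneg fun e _ => hnn _]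
    exact Finset.sum_congr rfl fun e _ => ih d _ (by simp; omega)

/-- A sequence that carries the word `c` in the window `[-n, n]`. -/
def padWord (n : ℕ) (c : Fin (2 * n + 1) → E) : CodeSpace E :=
  fun j => c ⟨(j + n).toNat % (2 * n + 1), Nat.mod_lt _ (by omega)⟩

lemma padWord_mem (n : ℕ) (c c' : Fin (2 * n + 1) → E) :
    padWord n c ∈ cylinderSet (-(n : ℤ)) (List.ofFn c') ↔ c = c' := by
  have key : ∀ j : Fin (2 * n + 1), padWord n c (-(n : ℤ) + (j : ℕ)) = c j := by
    intro j
    simp only [padWord]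
    congr 1
    ext
    simp only
    rw [show (-(n : ℤ) + (j : ℕ) + n) = ((j : ℕ) : ℤ) by ring, Int.toNat_natCast,
      Nat.mod_eq_of_lt j.2]
  constructor
  · intro h
    ext j
    have := h ⟨j, by rw [List.length_ofFn]; exact j.2⟩
    rw [key j, List.get_ofFn] at this
    exact this
  · rintro rfl ⟨j, hj⟩
    have hj' : j < 2 * n + 1 := by simpa using hj
    rw [List.get_ofFn]
    exact key ⟨j, hj'⟩

/-- A measure with the right values on the cylinders over the window `[-n, n]`. -/
def windowMeasure (S : MarkovSystem V E K) (μ : Measure K) (n : ℕ) : Measure (CodeSpace E) :=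
  ∑ c : Fin (2 * n + 1) → E,
    ENNReal.ofReal (∫ x, S.pathProb (List.ofFn c) x ∂μ) • Measure.dirac (padWord n c)

lemma windowMeasure_cylinder (S : MarkovSystem V E K) (μ : Measure K) (n : ℕ) (l : List E)
    (hl : l.length = 2 * n + 1) :
    S.windowMeasure μ n (cylinderSet (-(n : ℤ)) l)
      = ENNReal.ofReal (∫ x, S.pathProb l x ∂μ) := by
  classical
  obtain ⟨c, rfl⟩ : ∃ c : Fin (2 * n + 1) → E, l = List.ofFn c := by
    refine ⟨fun j => l.get (j.cast hl.symm), ?_⟩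
    refine List.ext_get (by rw [List.length_ofFn, hl]) fun j h1 h2 => ?_
    rw [List.get_ofFn]
    rfl
  simp only [windowMeasure, Measure.coe_finsetSum, Finset.sum_apply, Measure.smul_apply,
    Measure.dirac_apply' _ (cylinder_isClopen (-(n : ℤ)) _).isOpen.measurableSet, smul_eq_mul,
    Set.indicator_apply, padWord_mem]
  rw [Finset.sum_eq_single c]
  · simp only [if_true, Pi.one_apply, mul_one]
  · intro b _ hb
    rw [if_neg hb, mul_zero]
  · exact fun hc => absurd (Finset.mem_univ c) hc

lemma exists_markovCylinders (S : MarkovSystem V E K) (μ : Measure K) [IsProbabilityMeasure μ]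
    (hμ : S.IsInvariant μ) : ∃ M : Measure (CodeSpace E), S.HasMarkovCylinders μ M := by
  have hwin : ∀ (n : ℕ) (m : ℤ) (l : List E), -(n : ℤ) ≤ m → m + l.length ≤ n + 1 →
      S.windowMeasure μ n (cylinderSet m l) = ENNReal.ofReal (∫ x, S.pathProb l x ∂μ) := by
    intro n m l h1 h2
    have := S.hasCylinders_of_window μ hμ (S.windowMeasure μ n) (-(n : ℤ)) (2 * n + 1)
      (S.windowMeasure_cylinder μ n) (m + n).toNat (2 * n + 1 - l.length - (m + n).toNat) l
      (by omega)
    rwa [show -(n : ℤ) + ((m + n).toNat : ℤ) = m by omega] at this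
  have hprob : ∀ n, IsProbabilityMeasure (S.windowMeasure μ n) := fun n => ⟨by
    have h := hwin n 0 [] (by omega) (by simp; omega)
    have hu : cylinderSet (0 : ℤ) ([] : List E) = Set.univ := by
      ext σ; simp [cylinderSet]
    rw [hu] at h
    simpa [pathProb] using h⟩
  let Ms : ℕ → ProbabilityMeasure (CodeSpace E) := fun n => ⟨S.windowMeasure μ n, hprob n⟩
  obtain ⟨M, -, hM⟩ := isCompact_univ.ultrafilter_le_nhds
    ((Filter.hyperfilter ℕ).map Ms) (by simp)
  have hlim : Tendsto Ms (Filter.hyperfilter ℕ) (𝓝 M) := hM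
  refine ⟨M, fun m l => ?_⟩
  have h1 := ProbabilityMeasure.tendsto_measure_of_null_frontier_of_tendsto' hlim
    (E := cylinderSet m l) (by rw [(cylinder_isClopen m l).frontier_eq]; simp)
  refine tendsto_nhds_unique h1 (tendsto_const_nhds.congr' ?_)
  refine Nat.hyperfilter_le_atTop ?_
  filter_upwards [eventually_ge_atTop (m.natAbs + l.length)] with n hn
  exact (hwin n m l (by omega) (by omega)).symm

lemma markovCylinders_unique (S : MarkovSystem V E K) (μ : Measure K) [IsProbabilityMeasure μ]
    (M M' : Measure (CodeSpace E)) (h : S.HasMarkovCylinders μ M)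
    (h' : S.HasMarkovCylinders μ M') : M = M' := by
  let r : (n : ℕ) → CodeSpace E → Fin (2 * n + 1) → E := fun n σ j => σ (-(n : ℤ) + (j : ℕ))
  have hr : ∀ n, Measurable (r n) := fun n =>
    measurable_pi_lambda _ fun j => measurable_pi_apply _
  have hu : cylinderSet (0 : ℤ) ([] : List E) = Set.univ := by ext σ; simp [cylinderSet]
  have huniv : M Set.univ = M' Set.univ := by rw [← hu, h, h']
  have hfin : IsFiniteMeasure M := ⟨by rw [← hu, h]; exact ENNReal.ofReal_lt_top⟩
  have hcyl : ∀ n (c : Fin (2 * n + 1) → E),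
      r n ⁻¹' {c} = cylinderSet (-(n : ℤ)) (List.ofFn c) := by
    intro n c
    ext σ
    simp only [Set.mem_preimage, Set.mem_singleton_iff, cylinderSet, Set.mem_ofPred_eq]
    constructor
    · rintro hc ⟨j, hj⟩
      have hj' : j < 2 * n + 1 := by simpa using hj
      rw [List.get_ofFn]
      exact congrFun hc ⟨j, hj'⟩
    · intro hc
      ext j
      have := hc ⟨j, by rw [List.length_ofFn]; exact j.2⟩
      rw [List.get_ofFn] at this
      exact this
  refine ext_of_generate_finite {s | ∃ n A, s = r n ⁻¹' A} ?_ ?_ ?_ huniv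
  · apply le_antisymm
    · refine iSup_le fun j => ?_
      rintro _ ⟨B, -, rfl⟩
      refine MeasurableSpace.measurableSet_generateFrom
        ⟨j.natAbs, {c | c ⟨(j + j.natAbs).toNat, by omega⟩ ∈ B}, ?_⟩
      ext σ
      simp only [Set.mem_preimage, Set.mem_ofPred_eq, r]
      rw [show -(j.natAbs : ℤ) + ((j + j.natAbs).toNat : ℤ) = j by omega]
    · refine MeasurableSpace.generateFrom_le ?_
      rintro _ ⟨n, A, rfl⟩
      exact hr n A.toFinite.measurableSet
  · have step : ∀ n n' (A : Set (Fin (2 * n + 1) → E)), n ≤ n' →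
        ∃ B, r n ⁻¹' A = r n' ⁻¹' B := by
      intro n n' A hn
      refine ⟨{c | (fun j : Fin (2 * n + 1) => c ⟨j + (n' - n), by omega⟩) ∈ A}, ?_⟩
      ext σ
      simp only [Set.mem_preimage, Set.mem_ofPred_eq]
      have : r n σ = fun j : Fin (2 * n + 1) => r n' σ ⟨j + (n' - n), by omega⟩ := by
        ext j
        simp only [r]
        congr 1
        push_cast [Nat.cast_sub hn]
        ring
      rw [this]
    rintro _ ⟨n, A, rfl⟩ _ ⟨n', A', rfl⟩ -
    obtain ⟨B, hB⟩ := step n (max n n') A (le_max_left _ _)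
    obtain ⟨B', hB'⟩ := step n' (max n n') A' (le_max_right _ _)
    exact ⟨max n n', B ∩ B', by rw [hB, hB', Set.preimage_inter]⟩
  · rintro _ ⟨n, A, rfl⟩
    classical
    have hA : A = ↑(A.toFinite.toFinset) := by simp
    rw [hA, ← sum_measure_preimage_singleton _ fun c _ => hr n (measurableSet_singleton c),
      ← sum_measure_preimage_singleton _ fun c _ => hr n (measurableSet_singleton c)]
    exact Finset.sum_congr rfl fun c _ => by rw [hcyl, h, h']

/-- The generalized Markov measure associated with the Markov system and its invariant measure:
the unique Borel measure on the code space with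
`M(ₘ[e₁, …, e_k]) = ∫ p_{e₁}(x) p_{e₂}(w_{e₁} x) ⋯ dμ(x)` for all cylinders. -/
def markovMeasure (S : MarkovSystem V E K) (μ : Measure K) [IsProbabilityMeasure μ]
    (hμ : S.IsInvariant μ) : Measure (CodeSpace E) :=
  (S.exists_markovCylinders μ hμ).choose

lemma markovMeasure_cylinder (S : MarkovSystem V E K) (μ : Measure K) [IsProbabilityMeasure μ]
    (hμ : S.IsInvariant μ) : S.HasMarkovCylinders μ (S.markovMeasure μ hμ) :=
  (S.exists_markovCylinders μ hμ).choose_spec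

end Existence

/-! ### Coding map and energy function -/

/-- The sequences that are paths of the graph. -/
def pathSpace (S : MarkovSystem V E K) : Set (CodeSpace E) :=
  {σ | ∀ j : ℤ, S.term (σ j) = S.init (σ (j + 1))}

/-- `w_{σ_0} ∘ w_{σ_{-1}} ∘ ⋯ ∘ w_{σ_{-n}}`. -/
def backComp (S : MarkovSystem V E K) (σ : CodeSpace E) : ℕ → K → K
  | 0 => S.w (σ 0)
  | n + 1 => S.backComp σ n ∘ S.w (σ (-((n + 1 : ℕ) : ℤ)))

/-- `w_{σ_0} ∘ ⋯ ∘ w_{σ_{-n}} (x_{i(σ_{-n})})`, for chosen points `x_v`. -/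
def backOrbit (S : MarkovSystem V E K) (x : V → K) (σ : CodeSpace E) (n : ℕ) : K :=
  S.backComp σ n (x (S.init (σ (-(n : ℤ)))))

/-- The set `D` of paths along which the backward orbit converges. -/
def convergenceSet [TopologicalSpace K] (S : MarkovSystem V E K) (x : V → K) :
    Set (CodeSpace E) :=
  {σ | σ ∈ S.pathSpace ∧ ∃ y, Tendsto (S.backOrbit x σ) atTop (𝓝 y)}

/-- `Y = ⋂_{k ∈ ℤ} Sᵏ(D)`, where the `k`-th power of the left shift is `σ ↦ (σ_{j+k})_j`. -/
def codingDomain [TopologicalSpace K] (S : MarkovSystem V E K) (x : V → K) :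
    Set (CodeSpace E) :=
  ⋂ k : ℤ, (fun (σ : CodeSpace E) (j : ℤ) => σ (j + k)) '' S.convergenceSet x

open Classical in
/-- The coding map `F(σ) = lim_{m → -∞} w_{σ_0} ∘ ⋯ ∘ w_{σ_m} (x_{i(σ_m)})`, where the limit
exists (and an arbitrary value elsewhere). -/
def codingMap [TopologicalSpace K] (S : MarkovSystem V E K) (x : V → K) (σ : CodeSpace E) : K :=
  if h : ∃ y, Tendsto (S.backOrbit x σ) atTop (𝓝 y) then h.choose else x (S.init (σ 0))

open Classical in
/-- The energy function: `u(σ) = log p_{σ_1}(F(σ))` on `Y` and `-∞` off `Y`. -/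
def energy [TopologicalSpace K] (S : MarkovSystem V E K) (x : V → K) (σ : CodeSpace E) : EReal :=
  if σ ∈ S.codingDomain x then ((Real.log (S.p (σ 1) (S.codingMap x σ)) : ℝ) : EReal) else ⊥

end MarkovSystem

end

/-!
Let `M` be the Markov measure and `F` the coding map. A shift-invariant measure `Θ` with
`Θ(Y) < 1` has energy integral `-∞`. If `Θ(Y) = 1`, the entropy of `Θ` is at most the conditional
entropy of `σ₁` given the window `(σ_{-n}, …, σ₀)`, and Gibbs' inequality bounds the latter by
`∫ -log p_{σ₁}(y_n) dΘ`, where `y_n` is the end of the path `σ_{-n}, …, σ₀` started at the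
reference point. Since `log p` is bounded and continuous along such paths, `n → ∞` gives
`h_Θ(S) ≤ ∫ -log p_{σ₁}(F) dΘ`, so the pressure is nonpositive.

For `M` itself, `h_M(S)` is at least the mean entropy `∫ H(p(y)) dμ(y)` of one step: by Jensen's
inequality the entropy of a window of length `n` dominates the mean entropy of the random path of
length `n`, which is `n ∫ H(p) dμ` by invariance. On the other hand `∫ -log p_{σ₁}(y_n) dM` exceeds
`∫ H(p) dμ` by the mean relative entropy of the transition probabilities at the end of a random path
started at a `μ`-random point with respect to those at the end of the same path started at the
reference point. The two ends approach each other on average and `log p` is bounded and uniformly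
continuous, so this excess tends to `0`. Hence `∫ -log p_{σ₁}(F) dM = ∫ H(p) dμ ≤ h_M(S)`.
-/

section Preliminaries

lemma sum_word_succ {E M : Type*} [Fintype E] [AddCommMonoid M] {n : ℕ}
    (F : (Fin (n + 1) → E) → M) :
    ∑ c, F c = ∑ e, ∑ c : Fin n → E, F (Fin.cons (α := fun _ => E) e c) := by
  rw [← (Fin.consEquiv fun _ : Fin (n + 1) => E).sum_comp, Fintype.sum_prod_type]
  rfl

lemma abs_sum_mul_le_sum_mul {ι : Type*} [Fintype ι] {q f g : ι → ℝ} (hq : ∀ i, 0 ≤ q i)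
    (hfg : ∀ i, q i ≠ 0 → |f i| ≤ g i) : |∑ i, q i * f i| ≤ ∑ i, q i * g i := by
  refine (Finset.abs_sum_le_sum_abs _ _).trans (Finset.sum_le_sum fun i _ => ?_)
  rw [abs_mul, abs_of_nonneg (hq i)]
  by_cases hi : q i = 0
  · simp [hi]
  · exact mul_le_mul_of_nonneg_left (hfg i hi) (hq i)

lemma abs_negMulLog_le_one {t : ℝ} (ht₀ : 0 ≤ t) (ht₁ : t ≤ 1) : |Real.negMulLog t| ≤ 1 := by
  rw [abs_of_nonneg (Real.negMulLog_nonneg ht₀ ht₁)]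
  exact (Real.negMulLog_le_one_sub_self ht₀).trans (sub_le_self 1 ht₀)

lemma abs_sum_negMulLog_le_card {ι : Type*} [Fintype ι] {q : ι → ℝ} (hq₀ : ∀ i, 0 ≤ q i)
    (hq₁ : ∀ i, q i ≤ 1) : |∑ i, Real.negMulLog (q i)| ≤ Fintype.card ι := by
  refine (Finset.abs_sum_le_sum_abs _ _).trans ((Finset.sum_le_card_nsmul _ _ 1 fun i _ =>
    abs_negMulLog_le_one (hq₀ i) (hq₁ i)).trans_eq ?_)
  rw [nsmul_one, Finset.card_univ]

lemma lipschitzOnWith_log_Ici {δ : ℝ} (hδ : 0 < δ) :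
    LipschitzOnWith (Real.toNNReal δ⁻¹) Real.log (Set.Ici δ) := by
  refine .of_le_add_mul' _ fun s hs t ht => ?_
  have hs₀ : 0 < s := hδ.trans_le hs
  have ht₀ : 0 < t := hδ.trans_le ht
  rw [← sub_le_iff_le_add', ← Real.log_div hs₀.ne' ht₀.ne', Real.dist_eq]
  calc Real.log (s / t) ≤ s / t - 1 := Real.log_le_sub_one_of_pos (div_pos hs₀ ht₀)
    _ = t⁻¹ * (s - t) := by field_simp
    _ ≤ t⁻¹ * |s - t| := by gcongr; exact le_abs_self _
    _ ≤ δ⁻¹ * |s - t| := by gcongr; exact ht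

lemma exists_dist_le_add_mul_dist {α β : Type*} [PseudoMetricSpace α] [PseudoMetricSpace β]
    {f : α → β} {s : Set α} (hf : UniformContinuousOn f s) {B ε : ℝ}
    (hB : ∀ y ∈ s, ∀ z ∈ s, dist (f y) (f z) ≤ B) (hε : 0 < ε) :
    ∃ C, 0 ≤ C ∧ ∀ y ∈ s, ∀ z ∈ s, dist (f y) (f z) ≤ ε + C * dist y z := by
  obtain ⟨η, hη, hclose⟩ := Metric.uniformContinuousOn_iff.1 hf ε hε
  refine ⟨|B| / η, by positivity, fun y hy z hz => ?_⟩
  rcases lt_or_ge (dist y z) η with hd | hd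
  · exact (hclose y hy z hz hd).le.trans (le_add_of_nonneg_right (by positivity))
  · have hfar : |B| ≤ |B| / η * dist y z := by
      rw [div_mul_eq_mul_div, le_div_iff₀ hη]
      exact mul_le_mul_of_nonneg_left hd (abs_nonneg B)
    linarith [hB y hy z hz, le_abs_self B]

end Preliminaries

section FiniteEntropy

open ProbabilityTheory

lemma ae_measureReal_preimage_pos {Ω ι : Type*} [MeasurableSpace Ω] [Countable ι]
    {Θ : Measure Ω} [IsFiniteMeasure Θ] (X : Ω → ι) :
    ∀ᵐ ω ∂Θ, 0 < Θ.real (X ⁻¹' {X ω}) := by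
  have hnull : ∀ i, ∀ᵐ ω ∂Θ, X ω = i → 0 < Θ.real (X ⁻¹' {i}) := by
    intro i
    by_cases hi : Θ (X ⁻¹' {i}) = 0
    · filter_upwards [measure_eq_zero_iff_ae_notMem.1 hi] with ω hω hωi
      exact absurd hωi hω
    · exact .of_forall fun _ _ => ENNReal.toReal_pos hi (measure_ne_top _ _)
  filter_upwards [ae_all_iff.2 hnull] with ω hω
  exact hω _ rfl

lemma measureReal_preimage_prodMk {Ω ι κ : Type*} [MeasurableSpace Ω] [MeasurableSpace κ]
    [MeasurableSingletonClass κ] {Θ : Measure Ω} [IsFiniteMeasure Θ] (X : Ω → ι) {Y : Ω → κ}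
    (hY : Measurable Y) (x : ι) (y : κ) :
    Θ.real ((fun ω => (X ω, Y ω)) ⁻¹' {(x, y)})
      = Θ.real (Y ⁻¹' {y}) * Θ[|Y ⁻¹' {y}].real (X ⁻¹' {x}) := by
  have h := cond_mul_eq_inter (hY (measurableSet_singleton y)) (X ⁻¹' {x}) Θ
  rw [measureReal_def, measureReal_def, measureReal_def, ← ENNReal.toReal_mul, mul_comm, h]
  congr 2
  ext ω
  simp [and_comm]

lemma ae_cond_preimage_pos {Ω ι κ : Type*} [MeasurableSpace Ω] [Countable ι] [Countable κ]
    [MeasurableSpace κ] [MeasurableSingletonClass κ] {Θ : Measure Ω} [IsFiniteMeasure Θ]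
    (X : Ω → ι) {Y : Ω → κ} (hY : Measurable Y) :
    ∀ᵐ ω ∂Θ, 0 < Θ[|Y ⁻¹' {Y ω}].real (X ⁻¹' {X ω}) := by
  filter_upwards [ae_measureReal_preimage_pos fun ω => (X ω, Y ω)] with ω hω
  rw [measureReal_preimage_prodMk X hY] at hω
  exact pos_of_mul_pos_right hω measureReal_nonneg

variable {Ω ι κ ν : Type*} [MeasurableSpace Ω]
  [Fintype ι] [MeasurableSpace ι] [MeasurableSingletonClass ι]
  [Fintype κ] [MeasurableSpace κ] [MeasurableSingletonClass κ]
  [Fintype ν] [MeasurableSpace ν] [MeasurableSingletonClass ν]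

/-- The Shannon entropy `H(X)` of a random variable with finitely many values. -/
noncomputable def finEntropy (Θ : Measure Ω) (X : Ω → ι) : ℝ :=
  ∑ i, Real.negMulLog (Θ.real (X ⁻¹' {i}))

/-- The conditional Shannon entropy `H(X | Y)`, defined through the chain rule
`H(X, Y) = H(Y) + H(X | Y)`. -/
noncomputable def condEntropy (Θ : Measure Ω) (X : Ω → ι) (Y : Ω → κ) : ℝ :=
  finEntropy Θ (fun ω => (X ω, Y ω)) - finEntropy Θ Y

variable {Θ : Measure Ω}

lemma finEntropy_comp_measurePreserving {T : Ω → Ω} (hT : MeasurePreserving T Θ Θ)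
    {X : Ω → ι} (hX : Measurable X) : finEntropy Θ (X ∘ T) = finEntropy Θ X := by
  simp only [finEntropy, Set.preimage_comp,
    hT.measureReal_preimage (hX (measurableSet_singleton _)).nullMeasurableSet]

lemma condEntropy_comp_measurePreserving {T : Ω → Ω} (hT : MeasurePreserving T Θ Θ)
    {X : Ω → ι} {Y : Ω → κ} (hX : Measurable X) (hY : Measurable Y) :
    condEntropy Θ (X ∘ T) (Y ∘ T) = condEntropy Θ X Y :=
  congrArg₂ (· - ·) (finEntropy_comp_measurePreserving hT (hX.prodMk hY))
    (finEntropy_comp_measurePreserving hT hY)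

lemma sum_cond_preimage_le_one {X : Ω → ι} (hX : Measurable X) (s : Set Ω) :
    ∑ x, Θ[|s].real (X ⁻¹' {x}) ≤ 1 := by
  rw [sum_measureReal_preimage_singleton _ fun x _ => hX (measurableSet_singleton x)]
  exact measureReal_le_one

section IsFiniteMeasure

variable [IsFiniteMeasure Θ]

lemma integrable_comp_of_finite {ι : Type*} [Finite ι] [MeasurableSpace ι]
    [MeasurableSingletonClass ι] {Z : Ω → ι} (hZ : Measurable Z) (f : ι → ℝ) :
    Integrable (fun ω => f (Z ω)) Θ :=
  (Integrable.of_finite (μ := Θ.map Z) (f := f)).comp_measurable hZ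

lemma integral_comp_of_fintype {Z : Ω → ι} (hZ : Measurable Z) (f : ι → ℝ) :
    ∫ ω, f (Z ω) ∂Θ = ∑ z, Θ.real (Z ⁻¹' {z}) * f z := by
  rw [← integral_map hZ.aemeasurable (measurable_of_finite f).aestronglyMeasurable,
    integral_fintype Integrable.of_finite]
  simp only [map_measureReal_apply hZ (measurableSet_singleton _), smul_eq_mul]

lemma finEntropy_eq_integral {X : Ω → ι} (hX : Measurable X) :
    finEntropy Θ X = ∫ ω, -Real.log (Θ.real (X ⁻¹' {X ω})) ∂Θ := by
  rw [integral_comp_of_fintype hX fun i => -Real.log (Θ.real (X ⁻¹' {i}))]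
  simp only [finEntropy, Real.negMulLog, neg_mul, mul_neg]

lemma finEntropy_le_of_factorsThrough {X : Ω → κ} {Z : Ω → ι} (hX : Measurable X)
    (hZ : Measurable Z) (h : X.FactorsThrough Z) : finEntropy Θ X ≤ finEntropy Θ Z := by
  rw [finEntropy_eq_integral hX, finEntropy_eq_integral hZ]
  refine integral_mono_ae
    (integrable_comp_of_finite hX fun i => -Real.log (Θ.real (X ⁻¹' {i})))
    (integrable_comp_of_finite hZ fun i => -Real.log (Θ.real (Z ⁻¹' {i}))) ?_
  filter_upwards [ae_measureReal_preimage_pos Z] with ω hω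
  exact neg_le_neg (Real.log_le_log hω (measureReal_mono fun ω' hω' => h hω'))

lemma condEntropy_nonneg {X : Ω → ι} {Y : Ω → κ} (hX : Measurable X) (hY : Measurable Y) :
    0 ≤ condEntropy Θ X Y :=
  sub_nonneg.2 <| finEntropy_le_of_factorsThrough hY (hX.prodMk hY) fun _ _ h => congrArg Prod.snd h

lemma condEntropy_le_of_factorsThrough_left {X : Ω → ι} {X' : Ω → ν} {Y : Ω → κ}
    (hX : Measurable X) (hX' : Measurable X') (hY : Measurable Y)
    (h : X'.FactorsThrough fun ω => (X ω, Y ω)) : condEntropy Θ X' Y ≤ condEntropy Θ X Y :=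
  sub_le_sub_right (finEntropy_le_of_factorsThrough (hX'.prodMk hY) (hX.prodMk hY)
    fun _ _ hω => Prod.ext (h hω) (Prod.ext_iff.1 hω).2) _

lemma condEntropy_eq_integral {X : Ω → ι} {Y : Ω → κ} (hX : Measurable X) (hY : Measurable Y) :
    condEntropy Θ X Y = ∫ ω, -Real.log (Θ[|Y ⁻¹' {Y ω}].real (X ⁻¹' {X ω})) ∂Θ := by
  rw [condEntropy, finEntropy_eq_integral (hX.prodMk hY), finEntropy_eq_integral hY,
    ← integral_sub (integrable_comp_of_finite (hX.prodMk hY) fun z =>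
      -Real.log (Θ.real ((fun ω => (X ω, Y ω)) ⁻¹' {z})))
    (integrable_comp_of_finite hY fun y => -Real.log (Θ.real (Y ⁻¹' {y})))]
  refine integral_congr_ae ?_
  filter_upwards [ae_measureReal_preimage_pos Y, ae_cond_preimage_pos X hY] with ω hYω hXω
  rw [measureReal_preimage_prodMk X hY, Real.log_mul hYω.ne' hXω.ne']
  ring

end IsFiniteMeasure

variable [IsProbabilityMeasure Θ]

lemma finEntropy_le_integral_neg_log {X : Ω → ι} (hX : Measurable X) {q : ι → ℝ}
    (hq : ∀ i, 0 ≤ q i) (hsum : ∑ i, q i ≤ 1) (hpos : ∀ᵐ ω ∂Θ, 0 < q (X ω)) :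
    finEntropy Θ X ≤ ∫ ω, -Real.log (q (X ω)) ∂Θ := by
  set r : ι → ℝ := fun i => Θ.real (X ⁻¹' {i})
  have hratio : ∫ ω, q (X ω) / r (X ω) ∂Θ ≤ 1 := by
    rw [integral_comp_of_fintype hX fun i => q i / r i]
    refine (Finset.sum_le_sum fun i _ => ?_).trans hsum
    exact mul_div_left_comm (r i) (q i) (r i) ▸
      mul_le_of_le_one_right (hq i) (div_self_le_one (r i))
  have hmono : ∫ ω, -Real.log (r (X ω)) + Real.log (q (X ω)) ∂Θ
      ≤ ∫ ω, q (X ω) / r (X ω) - 1 ∂Θ := by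
    refine integral_mono_ae
      (integrable_comp_of_finite hX fun i => -Real.log (r i) + Real.log (q i))
      (integrable_comp_of_finite hX fun i => q i / r i - 1) ?_
    filter_upwards [hpos, ae_measureReal_preimage_pos X] with ω hqω hrω
    have := Real.log_le_sub_one_of_pos (div_pos hqω hrω)
    rw [Real.log_div hqω.ne' hrω.ne'] at this
    simp only [r]
    linarith
  rw [integral_add (integrable_comp_of_finite hX fun i => -Real.log (r i))
    (integrable_comp_of_finite hX fun i => Real.log (q i)),
    integral_sub (integrable_comp_of_finite hX fun i => q i / r i) (integrable_const _),
    integral_const, probReal_univ, one_smul] at hmono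
  rw [finEntropy_eq_integral hX, integral_neg (f := fun ω => Real.log (q (X ω)))]
  linarith

lemma finEntropy_le_log_card {X : Ω → ι} (hX : Measurable X) :
    finEntropy Θ X ≤ Real.log (Fintype.card ι) := by
  obtain ⟨ω⟩ := nonempty_of_isProbabilityMeasure Θ
  have hcard : 0 < (Fintype.card ι : ℝ) := Nat.cast_pos.2 (Fintype.card_pos_iff.2 ⟨X ω⟩)
  refine (finEntropy_le_integral_neg_log (q := fun _ => (Fintype.card ι : ℝ)⁻¹) hX
    (fun _ => by positivity) ?_ (.of_forall fun _ => by positivity)).trans ?_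
  · simp [hcard.ne']
  · simp

lemma condEntropy_le_integral_neg_log {X : Ω → ι} {Y : Ω → κ} (hX : Measurable X)
    (hY : Measurable Y) {Q : κ → ι → ℝ} (hQ : ∀ y x, 0 ≤ Q y x) (hsum : ∀ y, ∑ x, Q y x ≤ 1)
    (hpos : ∀ᵐ ω ∂Θ, 0 < Q (Y ω) (X ω)) :
    condEntropy Θ X Y ≤ ∫ ω, -Real.log (Q (Y ω) (X ω)) ∂Θ := by
  have hgibbs := finEntropy_le_integral_neg_log (Θ := Θ) (hX.prodMk hY)
    (q := fun z => Θ.real (Y ⁻¹' {z.2}) * Q z.2 z.1)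
    (fun z => mul_nonneg measureReal_nonneg (hQ _ _)) ?_ ?_
  · have hsplit : ∫ ω, -Real.log (Θ.real (Y ⁻¹' {Y ω}) * Q (Y ω) (X ω)) ∂Θ
        = finEntropy Θ Y + ∫ ω, -Real.log (Q (Y ω) (X ω)) ∂Θ := by
      rw [finEntropy_eq_integral hY, ← integral_add
        (integrable_comp_of_finite hY fun y => -Real.log (Θ.real (Y ⁻¹' {y})))
        (integrable_comp_of_finite (hX.prodMk hY) fun z => -Real.log (Q z.2 z.1))]
      refine integral_congr_ae ?_
      filter_upwards [ae_measureReal_preimage_pos Y, hpos] with ω hYω hQω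
      rw [Real.log_mul hYω.ne' hQω.ne', neg_add]
    rw [condEntropy]
    linarith
  · calc ∑ z : ι × κ, Θ.real (Y ⁻¹' {z.2}) * Q z.2 z.1
        = ∑ y, Θ.real (Y ⁻¹' {y}) * ∑ x, Q y x := by
          simp only [Fintype.sum_prod_type_right, Finset.mul_sum]
      _ ≤ ∑ y, Θ.real (Y ⁻¹' {y}) :=
          Finset.sum_le_sum fun y _ => mul_le_of_le_one_right measureReal_nonneg (hsum y)
      _ = 1 := by
          rw [sum_measureReal_preimage_singleton _ fun y _ => hY (measurableSet_singleton y)]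
          simp
  · filter_upwards [ae_measureReal_preimage_pos Y, hpos] with ω hYω hQω
    exact mul_pos hYω hQω

lemma condEntropy_le_finEntropy {X : Ω → ι} {Y : Ω → κ} (hX : Measurable X)
    (hY : Measurable Y) : condEntropy Θ X Y ≤ finEntropy Θ X := by
  rw [finEntropy_eq_integral hX]
  refine condEntropy_le_integral_neg_log hX hY (Q := fun _ x => Θ.real (X ⁻¹' {x}))
    (fun _ _ => measureReal_nonneg) (fun _ => ?_) (ae_measureReal_preimage_pos X)
  rw [sum_measureReal_preimage_singleton _ fun x _ => hX (measurableSet_singleton x)]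
  exact measureReal_le_one

lemma condEntropy_le_of_factorsThrough_right {X : Ω → ι} {Y : Ω → κ} {Y' : Ω → ν}
    (hX : Measurable X) (hY : Measurable Y) (hY' : Measurable Y') (h : Y'.FactorsThrough Y) :
    condEntropy Θ X Y ≤ condEntropy Θ X Y' := by
  obtain ⟨ω₀⟩ := nonempty_of_isProbabilityMeasure Θ
  have : Nonempty ν := ⟨Y' ω₀⟩
  obtain ⟨g, rfl⟩ := (Function.factorsThrough_iff Y').1 h
  rw [condEntropy_eq_integral hX hY']
  exact condEntropy_le_integral_neg_log hX hY
    (Q := fun y x => Θ[|(g ∘ Y) ⁻¹' {g y}].real (X ⁻¹' {x})) (fun _ _ => measureReal_nonneg)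
    (fun _ => sum_cond_preimage_le_one hX _) (ae_cond_preimage_pos X hY')

lemma condEntropy_pi_le {α : Type*} [Fintype α] [DecidableEq α] {X : α → Ω → ι} {Y : Ω → κ}
    (hX : ∀ i, Measurable (X i)) (hY : Measurable Y) :
    condEntropy Θ (fun ω i => X i ω) Y ≤ ∑ i, condEntropy Θ (X i) Y := by
  have hpos : ∀ᵐ ω ∂Θ, ∀ i, 0 < Θ[|Y ⁻¹' {Y ω}].real (X i ⁻¹' {X i ω}) :=
    ae_all_iff.2 fun i => ae_cond_preimage_pos (X i) hY
  calc condEntropy Θ (fun ω i => X i ω) Y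
      ≤ ∫ ω, -Real.log (∏ i, Θ[|Y ⁻¹' {Y ω}].real (X i ⁻¹' {X i ω})) ∂Θ := by
        refine condEntropy_le_integral_neg_log (measurable_pi_lambda _ hX) hY
          (Q := fun y x => ∏ i, Θ[|Y ⁻¹' {y}].real (X i ⁻¹' {x i}))
          (fun _ _ => Finset.prod_nonneg fun _ _ => measureReal_nonneg) (fun y => ?_) ?_
        · rw [← Fintype.prod_sum fun i x => Θ[|Y ⁻¹' {y}].real (X i ⁻¹' {x})]
          exact Finset.prod_le_one (fun _ _ => Finset.sum_nonneg fun _ _ => measureReal_nonneg)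
            fun i _ => sum_cond_preimage_le_one (hX i) _
        · filter_upwards [hpos] with ω hω using Finset.prod_pos fun i _ => hω i
    _ = ∑ i, condEntropy Θ (X i) Y := by
        simp only [fun i => condEntropy_eq_integral (Θ := Θ) (hX i) hY]
        rw [← integral_finsetSum _ fun i _ => integrable_comp_of_finite ((hX i).prodMk hY)
          fun z => -Real.log (Θ[|Y ⁻¹' {z.2}].real (X i ⁻¹' {z.1}))]
        refine integral_congr_ae ?_
        filter_upwards [hpos] with ω hω
        rw [Real.log_prod fun i _ => (hω i).ne', Finset.sum_neg_distrib]

end FiniteEntropy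

section Shift

variable {E : Type*}

/-- The word `σ_m, …, σ_{m+n-1}` read off a bi-infinite sequence. -/
def codeWindow (m : ℤ) (n : ℕ) (σ : CodeSpace E) : Fin n → E := fun i => σ (m + (i : ℕ))

lemma leftShift_iterate_apply (k : ℕ) (σ : CodeSpace E) (j : ℤ) :
    leftShift^[k] σ j = σ (j + k) := by
  induction k generalizing σ with
  | zero => simp
  | succ k ih =>
    rw [Function.iterate_succ_apply, ih, leftShift]
    congr 1
    push_cast
    ring

lemma codeWindow_comp_leftShift_iterate (m : ℤ) (n k : ℕ) :
    (codeWindow m n : CodeSpace E → _) ∘ leftShift^[k] = codeWindow (m + k) n := by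
  funext σ i
  simp only [Function.comp_apply, codeWindow, leftShift_iterate_apply]
  congr 1
  ring

lemma codeWindow_preimage_singleton (m : ℤ) {n : ℕ} (c : Fin n → E) :
    codeWindow m n ⁻¹' {c} = cylinderSet m (List.ofFn c) := by
  ext σ
  simp [codeWindow, cylinderSet, funext_iff, Fin.forall_iff]

lemma codeWindow_prodMk_preimage_singleton (m : ℤ) {n : ℕ} (c : Fin n → E) (e : E) :
    (fun σ => (codeWindow m n σ, σ (m + n))) ⁻¹' {(c, e)}
      = cylinderSet m (List.ofFn c ++ [e]) := by
  have hsnoc : List.ofFn c ++ [e] = List.ofFn (Fin.snoc (α := fun _ => E) c e) := by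
    rw [List.ofFn_succ']
    simp
  ext σ
  rw [hsnoc, ← codeWindow_preimage_singleton]
  simp [codeWindow, funext_iff, Fin.forall_fin_succ']

lemma leftShift_preimage_cylinderSet (m : ℤ) (l : List E) :
    leftShift ⁻¹' cylinderSet m l = cylinderSet (m + 1) l := by
  ext σ
  simp only [cylinderSet, leftShift, Set.mem_preimage, Set.mem_ofPred_eq, add_right_comm]

lemma apply_eq_of_codeWindow_eq {m : ℤ} {n : ℕ} {σ τ : CodeSpace E}
    (h : codeWindow m n σ = codeWindow m n τ) {j : ℤ} (hmj : m ≤ j) (hjn : j < m + n) :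
    σ j = τ j := by
  have := congrFun h ⟨(j - m).toNat, by omega⟩
  simp only [codeWindow] at this
  rwa [show m + ((j - m).toNat : ℤ) = j by omega] at this

lemma factorsThrough_codeWindow {m m' : ℤ} {n n' : ℕ} (hm : m ≤ m') (hn : m' + n' ≤ m + n) :
    (codeWindow m' n' : CodeSpace E → _).FactorsThrough (codeWindow m n) := fun _ _ h =>
  funext fun _ => apply_eq_of_codeWindow_eq h (by omega) (by omega)

variable [MeasurableSpace E]

lemma measurable_codeWindow (m : ℤ) (n : ℕ) :
    Measurable (codeWindow m n : CodeSpace E → Fin n → E) :=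
  measurable_pi_lambda _ fun _ => measurable_pi_apply _

lemma measurable_leftShift : Measurable (leftShift : CodeSpace E → CodeSpace E) :=
  measurable_pi_lambda _ fun _ => measurable_pi_apply _

lemma exists_factorsThrough_codeWindow {C : Set (CodeSpace E)}
    (hC : C ∈ measurableCylinders fun _ : ℤ => E) :
    ∃ n : ℕ, (· ∈ C).FactorsThrough (codeWindow (-n) (2 * n + 1)) := by
  obtain ⟨s, A, -, rfl⟩ := (mem_measurableCylinders C).1 hC
  refine ⟨s.sup Int.natAbs, fun σ τ h => ?_⟩
  have hrestrict : s.restrict σ = s.restrict τ := funext fun j => by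
    have := Finset.le_sup (f := Int.natAbs) j.2
    exact apply_eq_of_codeWindow_eq h (by omega) (by omega)
  simp only [mem_cylinder, hrestrict]

end Shift

section Generator

lemma finEntropy_mem {Ω : Type*} [MeasurableSpace Ω] (Θ : Measure Ω) [IsProbabilityMeasure Θ]
    {B : Set Ω} (hB : MeasurableSet B) :
    finEntropy Θ (· ∈ B) = Real.binEntropy (Θ.real B) := by
  have hTrue : (· ∈ B) ⁻¹' {True} = B := by ext; simp
  have hFalse : (· ∈ B) ⁻¹' {False} = Bᶜ := by ext; simp
  rw [finEntropy, Fintype.sum_Prop, hTrue, hFalse, probReal_compl_eq_one_sub hB,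
    Real.binEntropy_eq_negMulLog_add_negMulLog_one_sub]

variable {E : Type*} [Fintype E] [MeasurableSpace E] [MeasurableSingletonClass E]
  {ι : Type*} [Fintype ι] [MeasurableSpace ι] [MeasurableSingletonClass ι]
  {Θ : Measure (CodeSpace E)} [IsProbabilityMeasure Θ]

lemma exists_condEntropy_mem_lt {B : Set (CodeSpace E)} (hB : MeasurableSet B) {ε : ℝ}
    (hε : 0 < ε) : ∃ n : ℕ, condEntropy Θ (· ∈ B) (codeWindow (-n) (2 * n + 1)) < ε := by
  obtain ⟨η, hη, hsmall⟩ := Metric.continuous_iff.1 Real.binEntropy_continuous 0 ε hε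
  obtain ⟨C, hC, -, hBC⟩ := (Measure.MeasureDense.of_generateFrom_isSetAlgebra_finite Θ
    isSetAlgebra_measurableCylinders generateFrom_measurableCylinders.symm).fin_meas_approx
    hB (measure_ne_top _ _) η hη
  obtain ⟨n, hn⟩ := exists_factorsThrough_codeWindow hC
  have hD : MeasurableSet (symmDiff B C) := hB.symmDiff (.of_mem_measurableCylinders hC)
  have hBD : (· ∈ B).FactorsThrough
      fun σ => (σ ∈ symmDiff B C, codeWindow (-n) (2 * n + 1) σ) := by
    intro σ τ h
    have hD := (Prod.ext_iff.1 h).1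
    have hC := hn (Prod.ext_iff.1 h).2
    simp only [Set.mem_symmDiff, eq_iff_iff] at hC hD ⊢
    tauto
  have hW := measurable_codeWindow (E := E) (-n) (2 * n + 1)
  refine ⟨n, ?_⟩
  calc condEntropy Θ (· ∈ B) (codeWindow (-n) (2 * n + 1))
      ≤ condEntropy Θ (· ∈ symmDiff B C) (codeWindow (-n) (2 * n + 1)) :=
        condEntropy_le_of_factorsThrough_left (measurable_mem.2 hD) (measurable_mem.2 hB) hW hBD
    _ ≤ finEntropy Θ (· ∈ symmDiff B C) := condEntropy_le_finEntropy (measurable_mem.2 hD) hW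
    _ = Real.binEntropy (Θ.real (symmDiff B C)) := finEntropy_mem Θ hD
    _ < ε := by
        have hdist : dist (Θ.real (symmDiff B C)) 0 < η := by
          rw [Real.dist_0_eq_abs, abs_of_nonneg measureReal_nonneg]
          exact (ENNReal.lt_ofReal_iff_toReal_lt (measure_ne_top _ _)).1 hBC
        have := hsmall _ hdist
        rw [Real.binEntropy_zero, Real.dist_0_eq_abs] at this
        exact (le_abs_self _).trans_lt this

lemma tendsto_condEntropy_mem_codeWindow {B : Set (CodeSpace E)} (hB : MeasurableSet B) :
    Tendsto (fun n : ℕ => condEntropy Θ (· ∈ B) (codeWindow (-n) (2 * n + 1))) atTop (𝓝 0) := by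
  have hB' : Measurable (· ∈ B) := measurable_mem.2 hB
  refine tendsto_order.2 ⟨fun ε hε => .of_forall fun n =>
    hε.trans_le (condEntropy_nonneg hB' (measurable_codeWindow _ _)), fun ε hε => ?_⟩
  obtain ⟨n₀, hn₀⟩ := exists_condEntropy_mem_lt (Θ := Θ) hB hε
  filter_upwards [eventually_ge_atTop n₀] with n hn
  exact (condEntropy_le_of_factorsThrough_right hB' (measurable_codeWindow _ _)
    (measurable_codeWindow _ _) (factorsThrough_codeWindow (by omega) (by omega))).trans_lt hn₀

lemma tendsto_condEntropy_codeWindow {P : CodeSpace E → ι} (hP : Measurable P) :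
    Tendsto (fun n : ℕ => condEntropy Θ P (codeWindow (-n) (2 * n + 1))) atTop (𝓝 0) := by
  classical
  have hcell : ∀ i, Measurable (· ∈ P ⁻¹' {i}) := fun i =>
    measurable_mem.2 (hP (measurableSet_singleton i))
  have hsum : Tendsto (fun n : ℕ => ∑ i, condEntropy Θ (· ∈ P ⁻¹' {i})
      (codeWindow (-n) (2 * n + 1))) atTop (𝓝 0) := by
    simpa using tendsto_finsetSum Finset.univ fun i _ =>
      tendsto_condEntropy_mem_codeWindow (Θ := Θ) (hP (measurableSet_singleton i))
  refine squeeze_zero (fun n => condEntropy_nonneg hP (measurable_codeWindow _ _))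
    (fun n => ?_) hsum
  refine (condEntropy_le_of_factorsThrough_left (measurable_pi_lambda _ hcell) hP
    (measurable_codeWindow _ _) fun σ τ h => ?_).trans
    (condEntropy_pi_le hcell (measurable_codeWindow _ _))
  have := congrFun (Prod.ext_iff.1 h).1 (P σ)
  simp only [Set.mem_preimage, Set.mem_singleton_iff, eq_iff_iff, true_iff] at this
  exact this.symm

end Generator

section EntropyOfShift

lemma joinEntropy_eq_finEntropy {X : Type*} [MeasurableSpace X] (T : X → X) (Θ : Measure X)
    {k : ℕ} (P : X → Fin k) (n : ℕ) :
    joinEntropy T Θ P n = finEntropy Θ (fun x (i : Fin n) => P (T^[i] x)) := by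
  refine Finset.sum_congr rfl fun c _ => ?_
  congr 2
  ext x
  simp [funext_iff]

variable {E : Type*} [Fintype E] [MeasurableSpace E] [MeasurableSingletonClass E]
  {Θ : Measure (CodeSpace E)}

lemma finEntropy_codeWindow (hΘ : MeasurePreserving leftShift Θ Θ) (m : ℤ) (n : ℕ) :
    finEntropy Θ (codeWindow m n) = finEntropy Θ (codeWindow 0 n) := by
  have hshift : ∀ (m : ℤ) (k : ℕ),
      finEntropy Θ (codeWindow (m + k) n) = finEntropy Θ (codeWindow m n) := fun m k => by
    rw [← codeWindow_comp_leftShift_iterate,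
      finEntropy_comp_measurePreserving (hΘ.iterate k) (measurable_codeWindow m n)]
  obtain ⟨k, rfl | rfl⟩ := m.eq_nat_or_neg
  · simpa using hshift 0 k
  · simpa using (hshift (-k) k).symm

variable [IsProbabilityMeasure Θ]

lemma subadditive_finEntropy_codeWindow (hΘ : MeasurePreserving leftShift Θ Θ) :
    Subadditive fun n => finEntropy Θ (codeWindow 0 n) := fun m n => by
  have hm := measurable_codeWindow (E := E) 0 m
  have hn := measurable_codeWindow (E := E) m n
  have hsplit : (codeWindow 0 (m + n) : CodeSpace E → _).FactorsThrough
      fun σ => (codeWindow m n σ, codeWindow 0 m σ) := by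
    intro σ τ h
    funext i
    rcases lt_or_ge (i : ℕ) m with hi | hi
    · exact apply_eq_of_codeWindow_eq (Prod.ext_iff.1 h).2 (by omega) (by omega)
    · exact apply_eq_of_codeWindow_eq (Prod.ext_iff.1 h).1 (by omega) (by omega)
  have hle := finEntropy_le_of_factorsThrough (Θ := Θ) (measurable_codeWindow 0 (m + n))
    (hn.prodMk hm) hsplit
  have hcond := condEntropy_le_finEntropy (Θ := Θ) hn hm
  rw [finEntropy_codeWindow hΘ m n, condEntropy] at hcond
  linarith

lemma tendsto_finEntropy_codeWindow_div (hΘ : MeasurePreserving leftShift Θ Θ) :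
    Tendsto (fun n : ℕ => finEntropy Θ (codeWindow 0 n) / n) atTop
      (𝓝 (subadditive_finEntropy_codeWindow hΘ).lim) := by
  refine (subadditive_finEntropy_codeWindow hΘ).tendsto_lim ⟨0, ?_⟩
  rintro _ ⟨n, rfl⟩
  exact div_nonneg (Finset.sum_nonneg fun c _ =>
    Real.negMulLog_nonneg measureReal_nonneg measureReal_le_one) n.cast_nonneg

lemma joinEntropy_leftShift_le (hΘ : MeasurePreserving leftShift Θ Θ) {k : ℕ}
    {P : CodeSpace E → Fin k} (hP : Measurable P) (n N : ℕ) :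
    joinEntropy leftShift Θ P N
      ≤ finEntropy Θ (codeWindow 0 N) + N * condEntropy Θ P (codeWindow (-n) (2 * n + 1))
        + finEntropy Θ (codeWindow 0 (2 * n)) := by
  have hW := measurable_codeWindow (E := E) (-n) (N + 2 * n)
  have hPi : ∀ i : Fin N, Measurable (P ∘ leftShift^[i]) := fun i =>
    hP.comp (measurable_leftShift.iterate _)
  have hcell : ∀ i : Fin N, condEntropy Θ (P ∘ leftShift^[i]) (codeWindow (-n) (N + 2 * n))
      ≤ condEntropy Θ P (codeWindow (-n) (2 * n + 1)) := fun i => by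
    rw [← condEntropy_comp_measurePreserving (hΘ.iterate i) hP (measurable_codeWindow _ _),
      codeWindow_comp_leftShift_iterate]
    exact condEntropy_le_of_factorsThrough_right (hPi i) hW (measurable_codeWindow _ _)
      (factorsThrough_codeWindow (by omega) (by omega))
  have hcond : condEntropy Θ (fun σ (i : Fin N) => P (leftShift^[i] σ))
      (codeWindow (-n) (N + 2 * n)) ≤ N * condEntropy Θ P (codeWindow (-n) (2 * n + 1)) :=
    (condEntropy_pi_le hPi hW).trans <| by
      simpa using Finset.sum_le_sum fun i (_ : i ∈ Finset.univ) => hcell i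
  have hjoin := finEntropy_le_of_factorsThrough (Θ := Θ) (measurable_pi_lambda _ hPi)
    ((measurable_pi_lambda _ hPi).prodMk hW) fun _ _ h => (Prod.ext_iff.1 h).1
  have hsub : finEntropy Θ (codeWindow 0 (N + 2 * n))
      ≤ finEntropy Θ (codeWindow 0 N) + finEntropy Θ (codeWindow 0 (2 * n)) :=
    subadditive_finEntropy_codeWindow hΘ N (2 * n)
  rw [← finEntropy_codeWindow hΘ (-n) (N + 2 * n)] at hsub
  rw [joinEntropy_eq_finEntropy]
  simp only [condEntropy, Function.comp_apply] at hcond hjoin hsub ⊢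
  linarith

lemma partitionEntropy_leftShift_le (hΘ : MeasurePreserving leftShift Θ Θ) {k : ℕ}
    {P : CodeSpace E → Fin k} (hP : Measurable P) :
    partitionEntropy leftShift Θ P ≤ (subadditive_finEntropy_codeWindow hΘ).lim := by
  set L := (subadditive_finEntropy_codeWindow hΘ).lim
  have hbound : ∀ n : ℕ, partitionEntropy leftShift Θ P
      ≤ ((L + condEntropy Θ P (codeWindow (-n) (2 * n + 1)) : ℝ) : EReal) := by
    intro n
    set h := condEntropy Θ P (codeWindow (-n) (2 * n + 1))
    have hlim : Tendsto (fun N : ℕ => finEntropy Θ (codeWindow 0 N) / N + h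
        + finEntropy Θ (codeWindow 0 (2 * n)) / N) atTop (𝓝 (L + h)) := by
      simpa using ((tendsto_finEntropy_codeWindow_div hΘ).add_const h).add
        (tendsto_const_div_atTop_nhds_zero_nat (finEntropy Θ (codeWindow 0 (2 * n))))
    rw [← ((continuous_coe_real_ereal.tendsto _).comp hlim).limsup_eq]
    refine limsup_le_limsup ?_
    filter_upwards [eventually_gt_atTop 0] with N hN
    have hN' : (0 : ℝ) < N := Nat.cast_pos.2 hN
    refine EReal.coe_le_coe_iff.2 ((div_le_div_of_nonneg_right
      (joinEntropy_leftShift_le hΘ hP n N) hN'.le).trans_eq ?_)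
    field_simp
    rfl
  have hlim := (continuous_coe_real_ereal.tendsto _).comp
    ((tendsto_condEntropy_codeWindow (Θ := Θ) hP).const_add L)
  rw [add_zero] at hlim
  exact ge_of_tendsto' hlim hbound

lemma ksEntropy_leftShift_eq_lim (hΘ : MeasurePreserving leftShift Θ Θ) :
    ksEntropy leftShift Θ = (subadditive_finEntropy_codeWindow hΘ).lim := by
  refine le_antisymm (iSup_le fun _ => iSup_le fun _ => iSup_le fun hP =>
    partitionEntropy_leftShift_le hΘ hP) ?_
  let P : CodeSpace E → Fin (Fintype.card E) := fun σ => Fintype.equivFin E (σ 0)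
  have hP : Measurable P := (measurable_of_finite _).comp (measurable_pi_apply 0)
  refine le_trans ?_ (le_iSup_of_le _ (le_iSup_of_le P (le_iSup_of_le hP le_rfl)))
  rw [← ((continuous_coe_real_ereal.tendsto _).comp
    (tendsto_finEntropy_codeWindow_div hΘ)).limsup_eq]
  refine limsup_le_limsup (.of_forall fun n => EReal.coe_le_coe_iff.2 ?_)
  rw [joinEntropy_eq_finEntropy]
  refine div_le_div_of_nonneg_right (finEntropy_le_of_factorsThrough (measurable_codeWindow 0 n)
    (measurable_pi_lambda _ fun i => hP.comp (measurable_leftShift.iterate i))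
    fun σ τ h => funext fun i => ?_) n.cast_nonneg
  simpa only [P, codeWindow, leftShift_iterate_apply] using
    (Fintype.equivFin E).injective (congrFun h i)

lemma ksEntropy_leftShift_le_log_card (hΘ : MeasurePreserving leftShift Θ Θ) :
    ksEntropy leftShift Θ ≤ Real.log (Fintype.card E) := by
  rw [ksEntropy_leftShift_eq_lim hΘ, EReal.coe_le_coe_iff]
  refine le_of_tendsto (tendsto_finEntropy_codeWindow_div hΘ) ?_
  filter_upwards [eventually_gt_atTop 0] with n hn
  rw [div_le_iff₀' (Nat.cast_pos.2 hn), ← Real.log_pow]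
  simpa using finEntropy_le_log_card (Θ := Θ) (measurable_codeWindow (E := E) 0 n)

lemma finEntropy_codeWindow_succ_le (m : ℤ) (n : ℕ) :
    finEntropy Θ (codeWindow m (n + 1))
      ≤ finEntropy Θ (codeWindow m n) + condEntropy Θ (fun σ => σ (m + n)) (codeWindow m n) := by
  rw [condEntropy, add_sub_cancel]
  refine finEntropy_le_of_factorsThrough (measurable_codeWindow m (n + 1))
    ((measurable_pi_apply _).prodMk (measurable_codeWindow m n)) fun σ τ h => funext fun i => ?_
  rcases Nat.lt_succ_iff_lt_or_eq.1 i.2 with hi | hi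
  · exact apply_eq_of_codeWindow_eq (Prod.ext_iff.1 h).2 (by omega) (by omega)
  · simpa only [codeWindow, hi] using (Prod.ext_iff.1 h).1

lemma finEntropy_codeWindow_add_le (hΘ : MeasurePreserving leftShift Θ Θ) (m : ℤ) (n k : ℕ) :
    finEntropy Θ (codeWindow 0 (n + k)) ≤ finEntropy Θ (codeWindow 0 n)
      + k * condEntropy Θ (fun σ => σ (m + n)) (codeWindow m n) := by
  induction k with
  | zero => simp
  | succ k ih =>
    have hstep := finEntropy_codeWindow_succ_le (Θ := Θ) (m - k) (n + k)
    have hcond : condEntropy Θ (fun σ => σ (m + n)) (codeWindow (m - k) (n + k))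
        ≤ condEntropy Θ (fun σ => σ (m + n)) (codeWindow m n) :=
      condEntropy_le_of_factorsThrough_right (measurable_pi_apply _) (measurable_codeWindow _ _)
        (measurable_codeWindow _ _) (factorsThrough_codeWindow (by omega) (by omega))
    rw [finEntropy_codeWindow hΘ _ (n + k + 1), finEntropy_codeWindow hΘ _ (n + k),
      show m - (k : ℤ) + ((n + k : ℕ) : ℤ) = m + n by push_cast; ring] at hstep
    rw [← add_assoc]
    push_cast
    linarith

lemma ksEntropy_leftShift_le_condEntropy (hΘ : MeasurePreserving leftShift Θ Θ) (m : ℤ) (n : ℕ) :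
    ksEntropy leftShift Θ ≤ condEntropy Θ (fun σ => σ (m + n)) (codeWindow m n) := by
  set h := condEntropy Θ (fun σ => σ (m + n)) (codeWindow m n)
  rw [ksEntropy_leftShift_eq_lim hΘ, EReal.coe_le_coe_iff]
  have hlim : Tendsto (fun N : ℕ => finEntropy Θ (codeWindow 0 n) / N + h) atTop (𝓝 h) := by
    simpa using (tendsto_const_div_atTop_nhds_zero_nat _).add_const h
  refine le_of_tendsto_of_tendsto (tendsto_finEntropy_codeWindow_div hΘ) hlim ?_
  filter_upwards [eventually_ge_atTop n, eventually_gt_atTop 0] with N hnN hN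
  have hN' : (0 : ℝ) < N := Nat.cast_pos.2 hN
  rw [div_le_iff₀ hN', add_mul, div_mul_cancel₀ _ hN'.ne']
  have hle := finEntropy_codeWindow_add_le hΘ m n (N - n)
  rw [Nat.add_sub_cancel' hnN] at hle
  have hh : 0 ≤ h := condEntropy_nonneg (measurable_pi_apply _) (measurable_codeWindow _ _)
  have hsub : ((N - n : ℕ) : ℝ) ≤ N := Nat.cast_le.2 (Nat.sub_le N n)
  nlinarith

end EntropyOfShift

section EnergyIntegral

variable {X : Type*} [MeasurableSpace X] {Θ : Measure X} {u : X → EReal}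

lemma energyIntegral_eq_integral {g : X → ℝ} (hug : u =ᵐ[Θ] fun x => (g x : EReal))
    (hg : Integrable g Θ) (hg₀ : g ≤ᵐ[Θ] 0) : energyIntegral Θ u = ((∫ x, g x ∂Θ : ℝ) : EReal) := by
  have hlint : ∫⁻ x, (-u x).toENNReal ∂Θ = ENNReal.ofReal (∫ x, -g x ∂Θ) := by
    refine .trans (lintegral_congr_ae ?_) (ofReal_integral_eq_lintegral_ofReal hg.neg
      (hg₀.mono fun x hx => neg_nonneg.2 hx)).symm
    filter_upwards [hug] with x hx
    rw [hx, ← EReal.coe_neg, EReal.toENNReal_of_ne_top (EReal.coe_ne_top _), EReal.toReal_coe,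
      Pi.neg_apply]
  rw [energyIntegral, hlint, EReal.coe_ennreal_ofReal,
    max_eq_left (integral_nonneg_of_ae (hg₀.mono fun x hx => neg_nonneg.2 hx)), integral_neg,
    EReal.coe_neg, neg_neg]

lemma energyIntegral_eq_bot (hu : Measurable u) (hbot : Θ {x | u x = ⊥} ≠ 0) :
    energyIntegral Θ u = ⊥ := by
  have hset : {x | (-u x).toENNReal = ⊤} = {x | u x = ⊥} := by
    ext x
    simp [EReal.toENNReal_eq_top_iff, EReal.neg_eq_top_iff]
  have htop : ∫⁻ x, (-u x).toENNReal ∂Θ = ⊤ := lintegral_eq_top_of_measure_eq_top_ne_zero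
    hu.neg.ereal_toENNReal.aemeasurable (hset ▸ hbot)
  rw [energyIntegral, htop]
  rfl

end EnergyIntegral

namespace MarkovSystem

variable {V E K : Type*} [Fintype E] [MeasurableSpace K] {S : MarkovSystem V E K} {x : V → K}

section Paths

/-- The composition `w_{e_k} ∘ ⋯ ∘ w_{e_1}` along the word `e_1, …, e_k`. -/
def pathMap (S : MarkovSystem V E K) : List E → K → K
  | [], y => y
  | e :: l, y => S.pathMap l (S.w e y)

/-- The end point of the path `c`, started at the chosen point of the initial vertex set of its
first edge. -/
def wordPoint (S : MarkovSystem V E K) (x : V → K) {n : ℕ} (c : Fin (n + 1) → E) : K :=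
  S.pathMap (List.ofFn c) (x (S.init (c 0)))

lemma backComp_eq_pathMap (σ : CodeSpace E) (n : ℕ) :
    S.backComp σ n = S.pathMap (List.ofFn (codeWindow (-n) (n + 1) σ)) := by
  induction n with
  | zero => funext y; simp [backComp, pathMap, codeWindow]
  | succ n ih =>
    have htail : (fun i : Fin (n + 1) => codeWindow (-(n + 1 : ℕ)) (n + 1 + 1) σ i.succ)
        = codeWindow (-n) (n + 1) σ := by
      funext i
      simp only [codeWindow, Fin.val_succ]
      congr 1
      push_cast
      ring
    funext y
    rw [backComp, Function.comp_apply, ih, List.ofFn_succ (n := n + 1), pathMap, htail]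
    simp [codeWindow]

lemma backOrbit_eq_wordPoint (σ : CodeSpace E) (n : ℕ) :
    S.backOrbit x σ n = S.wordPoint x (codeWindow (-n) (n + 1) σ) := by
  rw [backOrbit, backComp_eq_pathMap, wordPoint]
  simp [codeWindow]

lemma backComp_mem {σ : CodeSpace E} (hσ : σ ∈ S.pathSpace) (n : ℕ) {y : K}
    (hy : y ∈ S.vertexSet (S.init (σ (-(n : ℤ))))) :
    S.backComp σ n y ∈ S.vertexSet (S.init (σ 1)) := by
  induction n generalizing y with
  | zero =>
    have h := S.w_mapsTo (σ 0) (by simpa using hy)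
    rwa [hσ 0] at h
  | succ n ih =>
    have h := S.w_mapsTo _ hy
    rw [hσ, show -((n + 1 : ℕ) : ℤ) + 1 = -(n : ℤ) by push_cast; ring] at h
    exact ih h

lemma backOrbit_mem (hx : ∀ v, x v ∈ S.vertexSet v) {σ : CodeSpace E} (hσ : σ ∈ S.pathSpace)
    (n : ℕ) : S.backOrbit x σ n ∈ S.vertexSet (S.init (σ 1)) :=
  backComp_mem hσ n (hx _)

lemma log_p_nonpos (S : MarkovSystem V E K) (e : E) (y : K) : Real.log (S.p e y) ≤ 0 :=
  Real.log_nonpos (S.p_nonneg e y) (S.p_le_one e y)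

end Paths

section Coding

variable [TopologicalSpace K]

lemma mem_codingDomain_iff {σ : CodeSpace E} :
    σ ∈ S.codingDomain x ↔ ∀ k : ℤ, (fun j => σ (j - k)) ∈ S.convergenceSet x := by
  rw [codingDomain, Set.mem_iInter]
  refine forall_congr' fun k => ⟨?_, fun h => ⟨_, h, ?_⟩⟩
  · rintro ⟨τ, hτ, rfl⟩
    simpa using hτ
  · funext j
    simp

lemma codingDomain_subset_convergenceSet : S.codingDomain x ⊆ S.convergenceSet x := fun σ hσ => by
  simpa using mem_codingDomain_iff.1 hσ 0

lemma tendsto_codingMap {σ : CodeSpace E} (hσ : ∃ y, Tendsto (S.backOrbit x σ) atTop (𝓝 y)) :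
    Tendsto (S.backOrbit x σ) atTop (𝓝 (S.codingMap x σ)) := by
  rw [codingMap, dif_pos hσ]
  exact hσ.choose_spec

lemma isClosed_vertexSet (hopen : ∀ v, IsOpen (S.vertexSet v)) (v : V) :
    IsClosed (S.vertexSet v) := by
  have hcompl : (S.vertexSet v)ᶜ = ⋃ v' ∈ {v' | v' ≠ v}, S.vertexSet v' := by
    refine (Set.iUnion₂_subset fun v' hv' => ?_).antisymm' fun y hy => ?_
    · exact (S.vertexSet_disjoint hv').subset_compl_right
    · obtain ⟨v', hv'⟩ := Set.mem_iUnion.1 (S.vertexSet_cover.symm ▸ Set.mem_univ y)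
      exact Set.mem_biUnion (fun h : v' = v => hy (h ▸ hv')) hv'
  rw [← isOpen_compl_iff, hcompl]
  exact isOpen_biUnion fun v' _ => hopen v'

variable (hx : ∀ v, x v ∈ S.vertexSet v) (hopen : ∀ v, IsOpen (S.vertexSet v))
include hx hopen

lemma codingMap_mem {σ : CodeSpace E} (hσ : σ ∈ S.convergenceSet x) :
    S.codingMap x σ ∈ S.vertexSet (S.init (σ 1)) :=
  (isClosed_vertexSet hopen _).mem_of_tendsto (tendsto_codingMap hσ.2)
    (.of_forall (backOrbit_mem hx hσ.1))

lemma tendsto_log_p_backOrbit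
    (hcont : ∀ e, ContinuousOn (S.p e) (S.vertexSet (S.init e)))
    (hpos : ∀ e, ∀ y ∈ S.vertexSet (S.init e), 0 < S.p e y)
    {σ : CodeSpace E} (hσ : σ ∈ S.convergenceSet x) :
    Tendsto (fun n => Real.log (S.p (σ 1) (S.backOrbit x σ n))) atTop
      (𝓝 (Real.log (S.p (σ 1) (S.codingMap x σ)))) := by
  have hmem := codingMap_mem hx hopen hσ
  exact (((hcont (σ 1)).continuousAt ((hopen _).mem_nhds hmem)).tendsto.comp
    (tendsto_codingMap hσ.2)).log (hpos _ _ hmem).ne'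

end Coding

section MeasurableCoding

variable [MeasurableSpace E] [MeasurableSingletonClass E]

lemma measurable_backOrbit (n : ℕ) : Measurable fun σ : CodeSpace E => S.backOrbit x σ n := by
  simp only [backOrbit_eq_wordPoint]
  exact (measurable_of_finite (S.wordPoint x)).comp (measurable_codeWindow _ _)

lemma measurable_log_p_one {f : CodeSpace E → K} (hf : Measurable f) :
    Measurable fun σ => Real.log (S.p (σ 1) (f σ)) := by
  have hp : Measurable fun z : E × K => S.p z.1 z.2 :=
    measurable_from_prod_countable_right S.p_measurable
  exact (hp.comp ((measurable_pi_apply 1).prodMk hf)).log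

lemma measurableSet_pathSpace : MeasurableSet S.pathSpace := by
  rw [pathSpace, Set.ofPred_forall]
  have hpair : ∀ j : ℤ, Measurable fun σ : CodeSpace E => (σ j, σ (j + 1)) := fun j =>
    (measurable_pi_apply j).prodMk (measurable_pi_apply (j + 1))
  exact .iInter fun j => hpair j (Set.toFinite {z : E × E | S.term z.1 = S.init z.2}).measurableSet

variable [TopologicalSpace K] [PolishSpace K] [BorelSpace K]

lemma measurableSet_exists_tendsto_backOrbit :
    MeasurableSet {σ : CodeSpace E | ∃ y, Tendsto (S.backOrbit x σ) atTop (𝓝 y)} :=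
  measurableSet_exists_tendsto measurable_backOrbit

lemma measurableSet_codingDomain : MeasurableSet (S.codingDomain x) := by
  have hpre : S.codingDomain x
      = ⋂ k : ℤ, (fun (σ : CodeSpace E) (j : ℤ) => σ (j - k)) ⁻¹' S.convergenceSet x := by
    ext σ
    simp [mem_codingDomain_iff]
  rw [hpre]
  exact .iInter fun k => (measurable_pi_lambda _ fun j => measurable_pi_apply _)
    (measurableSet_pathSpace.inter measurableSet_exists_tendsto_backOrbit)

lemma measurable_codingMap : Measurable (S.codingMap x) := by
  classical
  let C := {σ : CodeSpace E | ∃ y, Tendsto (S.backOrbit x σ) atTop (𝓝 y)}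
  refine measurable_of_tendsto_metrizable
    (f := fun n σ => if σ ∈ C then S.backOrbit x σ n else x (S.init (σ 0)))
    (fun n => (measurable_backOrbit n).ite measurableSet_exists_tendsto_backOrbit
      ((measurable_of_finite fun e => x (S.init e)).comp (measurable_pi_apply 0)))
    (tendsto_pi_nhds.2 fun σ => ?_)
  by_cases hσ : σ ∈ C
  · simpa only [hσ, if_true] using tendsto_codingMap hσ
  · simp only [hσ, if_false, codingMap, dif_neg (show ¬∃ _, _ from hσ)]
    exact tendsto_const_nhds

lemma isEnergyFunction_energy : IsEnergyFunction (S.energy x) where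
  measurable := .ite measurableSet_codingDomain
    (measurable_log_p_one measurable_codingMap).coe_real_ereal measurable_const
  nonpos σ := by
    rw [energy]
    split_ifs
    · exact_mod_cast S.log_p_nonpos _ _
    · exact bot_le

lemma energyIntegral_energy_eq_bot {Θ : Measure (CodeSpace E)}
    (hY : ¬ ∀ᵐ σ ∂Θ, σ ∈ S.codingDomain x) : energyIntegral Θ (S.energy x) = ⊥ := by
  refine energyIntegral_eq_bot isEnergyFunction_energy.measurable fun h => hY ?_
  refine measure_mono_null (fun σ hσ => ?_) h
  exact if_neg hσ

end MeasurableCoding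

section UpperBound

variable [MeasurableSpace E] [MeasurableSingletonClass E] {Θ : Measure (CodeSpace E)}
  (hx : ∀ v, x v ∈ S.vertexSet v)
include hx

lemma ksEntropy_le_integral_neg_log_p_backOrbit [IsProbabilityMeasure Θ]
    (hpos : ∀ e, ∀ y ∈ S.vertexSet (S.init e), 0 < S.p e y)
    (hΘ : MeasurePreserving leftShift Θ Θ) (hpath : ∀ᵐ σ ∂Θ, σ ∈ S.pathSpace) (n : ℕ) :
    ksEntropy leftShift Θ ≤ ((∫ σ, -Real.log (S.p (σ 1) (S.backOrbit x σ n)) ∂Θ : ℝ) : EReal) := by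
  have hone : -(n : ℤ) + ((n + 1 : ℕ) : ℤ) = 1 := by push_cast; ring
  have hks := ksEntropy_leftShift_le_condEntropy hΘ (-n) (n + 1)
  simp only [hone] at hks
  refine hks.trans (EReal.coe_le_coe_iff.2 ?_)
  simp only [backOrbit_eq_wordPoint]
  refine condEntropy_le_integral_neg_log (Q := fun c e => S.p e (S.wordPoint x c))
    (measurable_pi_apply 1) (measurable_codeWindow _ _) (fun _ _ => S.p_nonneg _ _)
    (fun c => (S.p_sum _).le) ?_
  filter_upwards [hpath] with σ hσ
  rw [← backOrbit_eq_wordPoint]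
  exact hpos _ _ (backOrbit_mem hx hσ n)

variable [TopologicalSpace K] (hopen : ∀ v, IsOpen (S.vertexSet v))
  {δ : ℝ} (hδ : 0 < δ) (hp : ∀ e, ∀ y ∈ S.vertexSet (S.init e), δ ≤ S.p e y)
include hopen hδ hp

lemma tendsto_integral_neg_log_p_backOrbit [IsFiniteMeasure Θ]
    (hcont : ∀ e, ContinuousOn (S.p e) (S.vertexSet (S.init e)))
    (hconv : ∀ᵐ σ ∂Θ, σ ∈ S.convergenceSet x) :
    Tendsto (fun n => ∫ σ, -Real.log (S.p (σ 1) (S.backOrbit x σ n)) ∂Θ) atTop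
      (𝓝 (∫ σ, -Real.log (S.p (σ 1) (S.codingMap x σ)) ∂Θ)) := by
  refine tendsto_integral_of_dominated_convergence (fun _ => -Real.log δ)
    (fun n => (measurable_log_p_one (measurable_backOrbit n)).neg.aestronglyMeasurable)
    (integrable_const _) (fun n => ?_) ?_
  · filter_upwards [hconv] with σ hσ
    rw [norm_neg, Real.norm_of_nonpos (S.log_p_nonpos _ _), neg_le_neg_iff]
    exact Real.log_le_log hδ (hp _ _ (backOrbit_mem hx hσ.1 n))
  · filter_upwards [hconv] with σ hσ
    exact (tendsto_log_p_backOrbit hx hopen hcont (fun e y hy => hδ.trans_le (hp e y hy)) hσ).neg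

variable [PolishSpace K] [BorelSpace K]

lemma energyIntegral_energy [IsFiniteMeasure Θ] (hY : ∀ᵐ σ ∂Θ, σ ∈ S.codingDomain x) :
    energyIntegral Θ (S.energy x)
      = ((∫ σ, Real.log (S.p (σ 1) (S.codingMap x σ)) ∂Θ : ℝ) : EReal) := by
  refine energyIntegral_eq_integral ?_ (.of_bound
    (measurable_log_p_one measurable_codingMap).aestronglyMeasurable (-Real.log δ) ?_)
    (.of_forall fun σ => S.log_p_nonpos _ _)
  · filter_upwards [hY] with σ hσ
    exact if_pos hσ
  · filter_upwards [hY] with σ hσ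
    rw [Real.norm_of_nonpos (S.log_p_nonpos _ _), neg_le_neg_iff]
    exact Real.log_le_log hδ
      (hp _ _ (codingMap_mem hx hopen (codingDomain_subset_convergenceSet hσ)))

theorem ksEntropy_add_energyIntegral_nonpos [IsProbabilityMeasure Θ]
    (hcont : ∀ e, ContinuousOn (S.p e) (S.vertexSet (S.init e)))
    (hΘ : MeasurePreserving leftShift Θ Θ) :
    ksEntropy leftShift Θ + energyIntegral Θ (S.energy x) ≤ 0 := by
  by_cases hY : ∀ᵐ σ ∂Θ, σ ∈ S.codingDomain x
  · have hconv : ∀ᵐ σ ∂Θ, σ ∈ S.convergenceSet x :=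
      hY.mono fun σ hσ => codingDomain_subset_convergenceSet hσ
    have hle : ksEntropy leftShift Θ
        ≤ ((∫ σ, -Real.log (S.p (σ 1) (S.codingMap x σ)) ∂Θ : ℝ) : EReal) :=
      ge_of_tendsto' ((continuous_coe_real_ereal.tendsto _).comp
        (tendsto_integral_neg_log_p_backOrbit hx hopen hδ hp hcont hconv))
        (ksEntropy_le_integral_neg_log_p_backOrbit hx (fun e y hy => hδ.trans_le (hp e y hy)) hΘ
          (hconv.mono fun σ hσ => hσ.1))
    rw [energyIntegral_energy hx hopen hδ hp hY]
    refine (add_le_add_left hle _).trans_eq ?_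
    rw [← EReal.coe_add, integral_neg, neg_add_cancel, EReal.coe_zero]
  · rw [energyIntegral_energy_eq_bot hY, EReal.add_bot]
    exact bot_le

end UpperBound

section RandomWords

lemma pathProb_ofFn_cons {n : ℕ} (e : E) (c : Fin n → E) (y : K) :
    S.pathProb (List.ofFn (Fin.cons (α := fun _ => E) e c)) y
      = S.p e y * S.pathProb (List.ofFn c) (S.w e y) := by
  rw [List.ofFn_cons, pathProb]

lemma pathMap_ofFn_cons {n : ℕ} (e : E) (c : Fin n → E) (y : K) :
    S.pathMap (List.ofFn (Fin.cons (α := fun _ => E) e c)) y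
      = S.pathMap (List.ofFn c) (S.w e y) := by
  rw [List.ofFn_cons, pathMap]

lemma pathProb_append_singleton (l : List E) (e : E) (y : K) :
    S.pathProb (l ++ [e]) y = S.pathProb l y * S.p e (S.pathMap l y) := by
  induction l generalizing y with
  | nil => simp [pathProb, pathMap]
  | cons f l ih => rw [List.cons_append, pathProb, pathProb, pathMap, ih, mul_assoc]

lemma measurable_pathMap (l : List E) : Measurable (S.pathMap l) := by
  induction l with
  | nil => exact measurable_id
  | cons e l ih => exact ih.comp (S.w_measurable e)

lemma sum_pathProb_ofFn (S : MarkovSystem V E K) (n : ℕ) (y : K) :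
    ∑ c : Fin n → E, S.pathProb (List.ofFn c) y = 1 := by
  induction n generalizing y with
  | zero => simp [pathProb]
  | succ n ih =>
    simp only [sum_word_succ, pathProb_ofFn_cons, ← Finset.mul_sum, ih, mul_one, S.p_sum]

lemma sum_pathProb_mul_comp_pathMap (f : K → ℝ) (n : ℕ) (y : K) :
    ∑ c : Fin n → E, S.pathProb (List.ofFn c) y * f (S.pathMap (List.ofFn c) y)
      = S.markovOp^[n] f y := by
  induction n generalizing y with
  | zero => simp [pathProb, pathMap]
  | succ n ih =>
    simp only [sum_word_succ, pathProb_ofFn_cons, pathMap_ofFn_cons, mul_assoc, ← Finset.mul_sum,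
      ih, Function.iterate_succ_apply', markovOp]

lemma measurable_markovOp {f : K → ℝ} (hf : Measurable f) : Measurable (S.markovOp f) :=
  Finset.measurable_fun_sum _ fun e _ => (S.p_measurable e).mul (hf.comp (S.w_measurable e))

lemma abs_markovOp_le {f : K → ℝ} {C : ℝ} (hf : ∀ y, |f y| ≤ C) (y : K) :
    |S.markovOp f y| ≤ C := by
  refine (abs_sum_mul_le_sum_mul (fun e => S.p_nonneg e y) fun e _ => hf (S.w e y)).trans_eq ?_
  rw [← Finset.sum_mul, S.p_sum, one_mul]

lemma integrable_markovOp_iterate {μ : Measure K} [IsFiniteMeasure μ] {f : K → ℝ} {C : ℝ}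
    (hf : Measurable f) (hC : ∀ y, |f y| ≤ C) (n : ℕ) : Integrable (S.markovOp^[n] f) μ := by
  induction n generalizing f with
  | zero => exact .of_bound hf.aestronglyMeasurable C (.of_forall hC)
  | succ _ ih => exact ih (measurable_markovOp hf) (abs_markovOp_le hC)

lemma integral_markovOp_iterate {μ : Measure K} (hμ : S.IsInvariant μ) {f : K → ℝ} {C : ℝ}
    (hf : Measurable f) (hC : ∀ y, |f y| ≤ C) (n : ℕ) :
    ∫ y, S.markovOp^[n] f y ∂μ = ∫ y, f y ∂μ := by
  induction n generalizing f with
  | zero => rfl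
  | succ n ih =>
    simp only [Function.iterate_succ_apply]
    exact (ih (measurable_markovOp hf) (abs_markovOp_le hC)).trans (hμ f hf ⟨C, hC⟩)

end RandomWords

section SameCell

/-- The points `y` and `z` lie in the same vertex set. -/
def SameCell (S : MarkovSystem V E K) (y z : K) : Prop :=
  ∃ v, y ∈ S.vertexSet v ∧ z ∈ S.vertexSet v

variable {y z : K}

lemma mem_vertexSet_of_p_ne_zero {e : E} (he : S.p e y ≠ 0) : y ∈ S.vertexSet (S.init e) :=
  not_imp_comm.1 (S.p_zero e y) he

lemma eq_of_mem_vertexSet {v v' : V} (hv : y ∈ S.vertexSet v) (hv' : y ∈ S.vertexSet v') :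
    v = v' :=
  S.vertexSet_disjoint.eq (Set.not_disjoint_iff.2 ⟨y, hv, hv'⟩)

lemma SameCell.mem_vertexSet (h : S.SameCell y z) {e : E} (he : S.p e y ≠ 0) :
    z ∈ S.vertexSet (S.init e) := by
  obtain ⟨v, hy, hz⟩ := h
  rwa [eq_of_mem_vertexSet (mem_vertexSet_of_p_ne_zero he) hy]

lemma SameCell.w (h : S.SameCell y z) {e : E} (he : S.p e y ≠ 0) :
    S.SameCell (S.w e y) (S.w e z) :=
  ⟨_, S.w_mapsTo e (mem_vertexSet_of_p_ne_zero he), S.w_mapsTo e (h.mem_vertexSet he)⟩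

lemma SameCell.pathMap (h : S.SameCell y z) {l : List E} (hl : S.pathProb l y ≠ 0) :
    S.SameCell (S.pathMap l y) (S.pathMap l z) := by
  induction l generalizing y z with
  | nil => exact h
  | cons e l ih => exact ih (h.w (left_ne_zero_of_mul hl)) (right_ne_zero_of_mul hl)

lemma wordPoint_eq_pathMap {v : V} (hy : y ∈ S.vertexSet v) {n : ℕ} {c : Fin (n + 1) → E}
    (hc : S.pathProb (List.ofFn c) y ≠ 0) :
    S.wordPoint x c = S.pathMap (List.ofFn c) (x v) := by
  rw [List.ofFn_succ] at hc
  rw [wordPoint, eq_of_mem_vertexSet hy (mem_vertexSet_of_p_ne_zero (left_ne_zero_of_mul hc))]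

lemma sum_pathProb_mul_dist_pathMap_le {K : Type*} [PseudoMetricSpace K] [MeasurableSpace K]
    {S : MarkovSystem V E K} {a : ℝ} (ha : S.IsContractive a) {y z : K} (h : S.SameCell y z)
    (n : ℕ) :
    ∑ c : Fin n → E, S.pathProb (List.ofFn c) y
      * dist (S.pathMap (List.ofFn c) y) (S.pathMap (List.ofFn c) z) ≤ a ^ n * dist y z := by
  induction n generalizing y z with
  | zero => simp [pathProb, MarkovSystem.pathMap]
  | succ n ih =>
    obtain ⟨v, hy, hz⟩ := h
    simp only [sum_word_succ, pathProb_ofFn_cons, pathMap_ofFn_cons, mul_assoc, ← Finset.mul_sum]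
    calc _ ≤ ∑ e, S.p e y * (a ^ n * dist (S.w e y) (S.w e z)) := by
          refine Finset.sum_le_sum fun e _ => ?_
          by_cases he : S.p e y = 0
          · simp [he]
          · exact mul_le_mul_of_nonneg_left (ih (SameCell.w ⟨v, hy, hz⟩ he)) (S.p_nonneg e y)
      _ = a ^ n * ∑ e, S.p e y * dist (S.w e y) (S.w e z) := by
          rw [Finset.mul_sum]
          exact Finset.sum_congr rfl fun e _ => mul_left_comm _ _ _
      _ ≤ a ^ n * (a * dist y z) :=
          mul_le_mul_of_nonneg_left (ha.2.2 v y hy z hz) (pow_nonneg ha.1.le n)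
      _ = a ^ (n + 1) * dist y z := by rw [pow_succ, mul_assoc]

end SameCell

section RelativeEntropy

/-- The entropy of the transition probabilities `(p_e(y))_e` out of the point `y`. -/
noncomputable def localEntropy (S : MarkovSystem V E K) (y : K) : ℝ :=
  ∑ e, Real.negMulLog (S.p e y)

/-- The Kullback-Leibler divergence of the transition probabilities at `z` from those at `y`
(a junk value instead of `∞` if `p_e(z) = 0 < p_e(y)` for some `e`). -/
noncomputable def relEntropy (S : MarkovSystem V E K) (y z : K) : ℝ :=
  ∑ e, S.p e y * (Real.log (S.p e y) - Real.log (S.p e z))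

/-- The mean divergence at the end point of a random path `c` of length `n + 1` from `y`, relative
to the end point of the same path started at the chosen point. -/
noncomputable def wordRelEntropy (S : MarkovSystem V E K) (x : V → K) (n : ℕ) (y : K) : ℝ :=
  ∑ c : Fin (n + 1) → E, S.pathProb (List.ofFn c) y
    * S.relEntropy (S.pathMap (List.ofFn c) y) (S.wordPoint x c)

lemma sum_p_mul_neg_log (y z : K) :
    ∑ e, S.p e y * -Real.log (S.p e z) = S.localEntropy y + S.relEntropy y z := by
  rw [localEntropy, relEntropy, ← Finset.sum_add_distrib]
  refine Finset.sum_congr rfl fun e _ => ?_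
  rw [Real.negMulLog]
  ring

lemma measurable_relEntropy_left (z : K) : Measurable fun y => S.relEntropy y z :=
  Finset.measurable_fun_sum _ fun e _ =>
    (S.p_measurable e).mul ((S.p_measurable e).log.sub measurable_const)

lemma measurable_wordRelEntropy (n : ℕ) : Measurable (S.wordRelEntropy x n) :=
  Finset.measurable_fun_sum _ fun _ _ =>
    (S.pathProb_measurable _).mul ((measurable_relEntropy_left _).comp (measurable_pathMap _))

lemma abs_relEntropy_le {y z : K} {B : ℝ}
    (hB : ∀ e, S.p e y ≠ 0 → |Real.log (S.p e y) - Real.log (S.p e z)| ≤ B) :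
    |S.relEntropy y z| ≤ B := by
  refine (abs_sum_mul_le_sum_mul (fun e => S.p_nonneg e y) hB).trans_eq ?_
  rw [← Finset.sum_mul, S.p_sum, one_mul]

lemma sameCell_pathMap_wordPoint (hx : ∀ v, x v ∈ S.vertexSet v) {y : K} {n : ℕ}
    {c : Fin (n + 1) → E} (hc : S.pathProb (List.ofFn c) y ≠ 0) :
    S.SameCell (S.pathMap (List.ofFn c) y) (S.wordPoint x c) := by
  obtain ⟨v, hy⟩ := Set.mem_iUnion.1 (S.vertexSet_cover.symm ▸ Set.mem_univ y)
  rw [wordPoint_eq_pathMap hy hc]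
  exact SameCell.pathMap ⟨v, hy, hx v⟩ hc

variable {δ : ℝ} (hδ : 0 < δ) (hp : ∀ e, ∀ y ∈ S.vertexSet (S.init e), δ ≤ S.p e y)
include hδ hp

lemma abs_log_p_sub_log_p_le {e : E} {y z : K} (hy : y ∈ S.vertexSet (S.init e))
    (hz : z ∈ S.vertexSet (S.init e)) :
    |Real.log (S.p e y) - Real.log (S.p e z)| ≤ -Real.log δ := by
  have hlogy := Real.log_le_log hδ (hp e y hy)
  have hlogz := Real.log_le_log hδ (hp e z hz)
  rw [abs_le]
  constructor <;> linarith [S.log_p_nonpos e y, S.log_p_nonpos e z]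

lemma SameCell.abs_relEntropy_le {y z : K} (h : S.SameCell y z) :
    |S.relEntropy y z| ≤ -Real.log δ :=
  MarkovSystem.abs_relEntropy_le fun _ he =>
    abs_log_p_sub_log_p_le hδ hp (mem_vertexSet_of_p_ne_zero he) (h.mem_vertexSet he)

lemma abs_wordRelEntropy_le (hx : ∀ v, x v ∈ S.vertexSet v) (n : ℕ) (y : K) :
    |S.wordRelEntropy x n y| ≤ -Real.log δ := by
  refine (abs_sum_mul_le_sum_mul (fun c => (S.pathProb_mem _ y).1) fun c hc =>
    (sameCell_pathMap_wordPoint hx hc).abs_relEntropy_le hδ hp).trans_eq ?_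
  rw [← Finset.sum_mul, sum_pathProb_ofFn, one_mul]

end RelativeEntropy

section Contraction

variable {K : Type*} [MetricSpace K] [MeasurableSpace K] {S : MarkovSystem V E K} {x : V → K}
  (hunif : ∀ e, UniformContinuousOn (S.p e) (S.vertexSet (S.init e)))
  {δ : ℝ} (hδ : 0 < δ) (hp : ∀ e, ∀ y ∈ S.vertexSet (S.init e), δ ≤ S.p e y)
include hunif hδ hp

lemma exists_abs_relEntropy_le {ε : ℝ} (hε : 0 < ε) :
    ∃ C, 0 ≤ C ∧ ∀ y z, S.SameCell y z → |S.relEntropy y z| ≤ ε + C * dist y z := by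
  have hlog : ∀ e, UniformContinuousOn (fun y => Real.log (S.p e y)) (S.vertexSet (S.init e)) :=
    fun e => (lipschitzOnWith_log_Ici hδ).uniformContinuousOn.comp (hunif e) fun y hy => hp e y hy
  choose C hC₀ hC using fun e => exists_dist_le_add_mul_dist (hlog e)
    (fun y hy z hz => abs_log_p_sub_log_p_le hδ hp hy hz) hε
  refine ⟨∑ e, C e, Finset.sum_nonneg fun e _ => hC₀ e, fun y z h =>
    abs_relEntropy_le fun e he => ?_⟩
  refine (hC e y (mem_vertexSet_of_p_ne_zero he) z (h.mem_vertexSet he)).trans ?_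
  gcongr
  exact Finset.single_le_sum (fun i _ => hC₀ i) (Finset.mem_univ e)

variable {a : ℝ} (ha : S.IsContractive a) (hx : ∀ v, x v ∈ S.vertexSet v)
include ha hx

lemma exists_abs_wordRelEntropy_le {ε : ℝ} (hε : 0 < ε) (y : K) :
    ∃ C, ∀ n, |S.wordRelEntropy x n y| ≤ ε + C * a ^ (n + 1) := by
  obtain ⟨C, hC₀, hC⟩ := exists_abs_relEntropy_le hunif hδ hp hε
  obtain ⟨v, hy⟩ := Set.mem_iUnion.1 (S.vertexSet_cover.symm ▸ Set.mem_univ y)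
  refine ⟨C * dist y (x v), fun n => ?_⟩
  calc |S.wordRelEntropy x n y|
      ≤ ∑ c : Fin (n + 1) → E, S.pathProb (List.ofFn c) y
          * (ε + C * dist (S.pathMap (List.ofFn c) y) (S.pathMap (List.ofFn c) (x v))) := by
        refine abs_sum_mul_le_sum_mul (fun c => (S.pathProb_mem _ y).1) fun c hc => ?_
        rw [wordPoint_eq_pathMap hy hc]
        exact hC _ _ (SameCell.pathMap ⟨v, hy, hx v⟩ hc)
    _ = ε + C * ∑ c : Fin (n + 1) → E, S.pathProb (List.ofFn c) y
          * dist (S.pathMap (List.ofFn c) y) (S.pathMap (List.ofFn c) (x v)) := by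
        simp only [mul_add, Finset.sum_add_distrib, ← Finset.sum_mul, sum_pathProb_ofFn, one_mul,
          Finset.mul_sum, mul_left_comm C]
    _ ≤ ε + C * (a ^ (n + 1) * dist y (x v)) := by
        gcongr
        exact sum_pathProb_mul_dist_pathMap_le ha ⟨v, hy, hx v⟩ (n + 1)
    _ = ε + C * dist y (x v) * a ^ (n + 1) := by ring

lemma tendsto_wordRelEntropy (y : K) :
    Tendsto (fun n => S.wordRelEntropy x n y) atTop (𝓝 0) := by
  refine Metric.tendsto_nhds.2 fun ε hε => ?_
  obtain ⟨C, hC⟩ := exists_abs_wordRelEntropy_le hunif hδ hp ha hx (half_pos hε) y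
  have hlim : Tendsto (fun n : ℕ => ε / 2 + C * a ^ (n + 1)) atTop (𝓝 (ε / 2 + C * 0)) :=
    (((tendsto_pow_atTop_nhds_zero_of_lt_one ha.1.le ha.2.1).comp
      (tendsto_add_atTop_nat 1)).const_mul C).const_add _
  filter_upwards [hlim.eventually_lt_const (by linarith : ε / 2 + C * 0 < ε)] with n hn
  rw [dist_zero_right, Real.norm_eq_abs]
  exact (hC n).trans_lt hn

lemma tendsto_integral_wordRelEntropy (μ : Measure K) [IsFiniteMeasure μ] :
    Tendsto (fun n => ∫ y, S.wordRelEntropy x n y ∂μ) atTop (𝓝 0) := by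
  simpa only [integral_zero] using tendsto_integral_of_dominated_convergence
    (fun _ => -Real.log δ) (fun n => (measurable_wordRelEntropy n).aestronglyMeasurable)
    (integrable_const _) (fun n => .of_forall (abs_wordRelEntropy_le hδ hp hx n))
    (.of_forall (tendsto_wordRelEntropy hunif hδ hp ha hx))

end Contraction

section WordEntropy

/-- The entropy of the random path of length `n` out of the point `y`. -/
noncomputable def wordEntropy (S : MarkovSystem V E K) (n : ℕ) (y : K) : ℝ :=
  ∑ c : Fin n → E, Real.negMulLog (S.pathProb (List.ofFn c) y)

lemma measurable_localEntropy : Measurable S.localEntropy :=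
  Finset.measurable_fun_sum _ fun e _ =>
    Real.continuous_negMulLog.measurable.comp (S.p_measurable e)

lemma abs_localEntropy_le (y : K) : |S.localEntropy y| ≤ Fintype.card E :=
  abs_sum_negMulLog_le_card (fun e => S.p_nonneg e y) fun e => S.p_le_one e y

lemma measurable_negMulLog_pathProb (l : List E) :
    Measurable fun y => Real.negMulLog (S.pathProb l y) :=
  Real.continuous_negMulLog.measurable.comp (S.pathProb_measurable l)

lemma measurable_wordEntropy (n : ℕ) : Measurable (S.wordEntropy n) :=
  Finset.measurable_fun_sum _ fun _ _ => measurable_negMulLog_pathProb _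

lemma abs_wordEntropy_le (n : ℕ) (y : K) :
    |S.wordEntropy n y| ≤ Fintype.card (Fin n → E) :=
  abs_sum_negMulLog_le_card (fun _ => (S.pathProb_mem _ y).1) fun _ => (S.pathProb_mem _ y).2

lemma wordEntropy_succ (n : ℕ) (y : K) :
    S.wordEntropy (n + 1) y = S.localEntropy y + S.markovOp (S.wordEntropy n) y := by
  simp only [wordEntropy, localEntropy, markovOp, sum_word_succ, pathProb_ofFn_cons,
    Real.negMulLog_mul, Finset.sum_add_distrib, ← Finset.mul_sum, ← Finset.sum_mul,
    sum_pathProb_ofFn, one_mul]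

lemma integral_wordEntropy {μ : Measure K} [IsFiniteMeasure μ] (hμ : S.IsInvariant μ) (n : ℕ) :
    ∫ y, S.wordEntropy n y ∂μ = n * ∫ y, S.localEntropy y ∂μ := by
  induction n with
  | zero => simp [wordEntropy, pathProb]
  | succ n ih =>
    have hlocal : Integrable S.localEntropy μ :=
      .of_bound measurable_localEntropy.aestronglyMeasurable _ (.of_forall abs_localEntropy_le)
    have hword : Integrable (S.markovOp (S.wordEntropy n)) μ :=
      .of_bound (measurable_markovOp (measurable_wordEntropy n)).aestronglyMeasurable _
        (.of_forall (abs_markovOp_le (abs_wordEntropy_le n)))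
    simp only [wordEntropy_succ]
    rw [integral_add hlocal hword, hμ _ (measurable_wordEntropy n) ⟨_, abs_wordEntropy_le n⟩, ih]
    push_cast
    ring

end WordEntropy

section MarkovMeasure

variable [TopologicalSpace E] [DiscreteTopology E] [MeasurableSpace E] [BorelSpace E]
  {μ : Measure K} [IsProbabilityMeasure μ] (hμ : S.IsInvariant μ)

lemma isProbabilityMeasure_markovMeasure : IsProbabilityMeasure (S.markovMeasure μ hμ) := by
  have hempty : cylinderSet 0 [] = (Set.univ : Set (CodeSpace E)) := by
    ext σ
    simp [cylinderSet]
  have h := S.markovMeasure_cylinder μ hμ 0 []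
  exact ⟨by simpa [hempty, pathProb] using h⟩

lemma markovMeasure_real_cylinderSet (m : ℤ) (l : List E) :
    (S.markovMeasure μ hμ).real (cylinderSet m l) = ∫ y, S.pathProb l y ∂μ := by
  rw [measureReal_def, S.markovMeasure_cylinder μ hμ,
    ENNReal.toReal_ofReal (integral_nonneg fun y => (S.pathProb_mem l y).1)]

lemma measurePreserving_leftShift_markovMeasure :
    MeasurePreserving leftShift (S.markovMeasure μ hμ) (S.markovMeasure μ hμ) := by
  refine ⟨measurable_leftShift, S.markovCylinders_unique μ _ _ (fun m l => ?_)
    (S.markovMeasure_cylinder μ hμ)⟩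
  rw [Measure.map_apply measurable_leftShift (cylinder_isClopen m l).isOpen.measurableSet,
    leftShift_preimage_cylinderSet, S.markovMeasure_cylinder μ hμ]

lemma mul_integral_localEntropy_le_finEntropy (n : ℕ) :
    n * ∫ y, S.localEntropy y ∂μ ≤ finEntropy (S.markovMeasure μ hμ) (codeWindow 0 n) := by
  have hint : ∀ c : Fin n → E,
      Integrable (fun y => Real.negMulLog (S.pathProb (List.ofFn c) y)) μ := fun c =>
    .of_bound (measurable_negMulLog_pathProb _).aestronglyMeasurable 1 (.of_forall fun y =>
      abs_negMulLog_le_one (S.pathProb_mem _ y).1 (S.pathProb_mem _ y).2)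
  rw [← integral_wordEntropy hμ]
  simp only [wordEntropy, finEntropy, codeWindow_preimage_singleton, markovMeasure_real_cylinderSet]
  rw [integral_finsetSum _ fun c _ => hint c]
  exact Finset.sum_le_sum fun c _ => Real.concaveOn_negMulLog.le_map_integral
    Real.continuous_negMulLog.continuousOn isClosed_Ici
    (.of_forall fun y => (S.pathProb_mem _ y).1) (S.pathProb_integrable μ _) (hint c)

lemma integral_localEntropy_le_ksEntropy :
    ((∫ y, S.localEntropy y ∂μ : ℝ) : EReal) ≤ ksEntropy leftShift (S.markovMeasure μ hμ) := by
  have := isProbabilityMeasure_markovMeasure hμ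
  have hshift := measurePreserving_leftShift_markovMeasure hμ
  rw [ksEntropy_leftShift_eq_lim hshift, EReal.coe_le_coe_iff]
  refine ge_of_tendsto (tendsto_finEntropy_codeWindow_div hshift) ?_
  filter_upwards [eventually_gt_atTop 0] with n hn
  rw [le_div_iff₀' (Nat.cast_pos.2 hn)]
  exact mul_integral_localEntropy_le_finEntropy hμ n

lemma integral_codeWindow_markovMeasure (m : ℤ) (n : ℕ) (f : (Fin n → E) → E → ℝ) :
    ∫ σ, f (codeWindow m n σ) (σ (m + n)) ∂(S.markovMeasure μ hμ)
      = ∫ y, ∑ c : Fin n → E, S.pathProb (List.ofFn c) y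
          * ∑ e, S.p e (S.pathMap (List.ofFn c) y) * f c e ∂μ := by
  have := isProbabilityMeasure_markovMeasure hμ
  have hreal : ∀ z : (Fin n → E) × E,
      (S.markovMeasure μ hμ).real ((fun σ => (codeWindow m n σ, σ (m + n))) ⁻¹' {z})
        = ∫ y, S.pathProb (List.ofFn z.1 ++ [z.2]) y ∂μ := fun ⟨c, e⟩ => by
    rw [codeWindow_prodMk_preimage_singleton, markovMeasure_real_cylinderSet]
  rw [integral_comp_of_fintype ((measurable_codeWindow m n).prodMk (measurable_pi_apply (m + n)))
    fun z => f z.1 z.2]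
  simp only [hreal, ← integral_mul_const]
  rw [← integral_finsetSum _ fun z _ => (S.pathProb_integrable μ _).mul_const _]
  simp only [Fintype.sum_prod_type, pathProb_append_singleton, Finset.mul_sum, mul_assoc]

variable {δ : ℝ} (hδ : 0 < δ) (hp : ∀ e, ∀ y ∈ S.vertexSet (S.init e), δ ≤ S.p e y)
  (hx : ∀ v, x v ∈ S.vertexSet v)
include hδ hp hx

lemma integral_neg_log_p_backOrbit (n : ℕ) :
    ∫ σ, -Real.log (S.p (σ 1) (S.backOrbit x σ n)) ∂(S.markovMeasure μ hμ)
      = ∫ y, S.localEntropy y ∂μ + ∫ y, S.wordRelEntropy x n y ∂μ := by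
  have hone : -(n : ℤ) + ((n + 1 : ℕ) : ℤ) = 1 := by push_cast; ring
  have hwindow := integral_codeWindow_markovMeasure hμ (-n) (n + 1) fun c e =>
    -Real.log (S.p e (S.wordPoint x c))
  simp only [hone, ← backOrbit_eq_wordPoint, sum_p_mul_neg_log, mul_add, Finset.sum_add_distrib,
    sum_pathProb_mul_comp_pathMap] at hwindow
  rw [hwindow, ← integral_markovOp_iterate hμ measurable_localEntropy abs_localEntropy_le (n + 1)]
  exact integral_add (integrable_markovOp_iterate measurable_localEntropy abs_localEntropy_le _)
    (.of_bound (measurable_wordRelEntropy n).aestronglyMeasurable _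
      (.of_forall (abs_wordRelEntropy_le hδ hp hx n)))

end MarkovMeasure

section LowerBound

variable [TopologicalSpace E] [DiscreteTopology E] [MeasurableSpace E] [BorelSpace E]
  {K : Type*} [MetricSpace K] [MeasurableSpace K]
  {S : MarkovSystem V E K} {x : V → K} {μ : Measure K} [IsProbabilityMeasure μ]
  (hμ : S.IsInvariant μ) (hopen : ∀ v, IsOpen (S.vertexSet v))
  {a : ℝ} (ha : S.IsContractive a)
  (hunif : ∀ e, UniformContinuousOn (S.p e) (S.vertexSet (S.init e)))
  {δ : ℝ} (hδ : 0 < δ) (hp : ∀ e, ∀ y ∈ S.vertexSet (S.init e), δ ≤ S.p e y)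
  (hx : ∀ v, x v ∈ S.vertexSet v)
  (hY : ∀ᵐ σ ∂(S.markovMeasure μ hμ), σ ∈ S.codingDomain x)
include hopen ha hunif hδ hp hx hY

lemma integral_neg_log_p_codingMap :
    ∫ σ, -Real.log (S.p (σ 1) (S.codingMap x σ)) ∂(S.markovMeasure μ hμ)
      = ∫ y, S.localEntropy y ∂μ := by
  have := isProbabilityMeasure_markovMeasure hμ
  have hcoding := tendsto_integral_neg_log_p_backOrbit hx hopen hδ hp
    (fun e => (hunif e).continuousOn) (hY.mono fun σ hσ => codingDomain_subset_convergenceSet hσ)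
  simp only [integral_neg_log_p_backOrbit hμ hδ hp hx] at hcoding
  have hentropy := (tendsto_integral_wordRelEntropy hunif hδ hp ha hx μ).const_add
    (∫ y, S.localEntropy y ∂μ)
  rw [add_zero] at hentropy
  exact tendsto_nhds_unique hcoding hentropy

theorem ksEntropy_add_energyIntegral_nonneg [PolishSpace K] [BorelSpace K] :
    0 ≤ ksEntropy leftShift (S.markovMeasure μ hμ)
      + energyIntegral (S.markovMeasure μ hμ) (S.energy x) := by
  have := isProbabilityMeasure_markovMeasure hμ
  rw [energyIntegral_energy hx hopen hδ hp hY]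
  refine Eq.trans_le ?_ (add_le_add_left (integral_localEntropy_le_ksEntropy hμ) _)
  rw [← integral_neg_log_p_codingMap hμ hopen ha hunif hδ hp hx hY, integral_neg,
    ← EReal.coe_add, neg_add_cancel, EReal.coe_zero]

end LowerBound

end MarkovSystem

theorem proposition1_general
    {V E K : Type*} [Fintype E]
    [TopologicalSpace E] [DiscreteTopology E] [MeasurableSpace E] [BorelSpace E]
    [MetricSpace K] [PolishSpace K] [MeasurableSpace K] [BorelSpace K]
    (S : MarkovSystem V E K)
    (hopen : ∀ v, IsOpen (S.vertexSet v))
    (a : ℝ) (ha : S.IsContractive a)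
    (hunif : ∀ e, UniformContinuousOn (S.p e) (S.vertexSet (S.init e)))
    (δ : ℝ) (hδ : 0 < δ) (hp : ∀ e, ∀ y ∈ S.vertexSet (S.init e), δ ≤ S.p e y)
    (x : V → K) (hx : ∀ v, x v ∈ S.vertexSet v)
    (μ : Measure K) [IsProbabilityMeasure μ] (hμ : S.IsInvariant μ)
    (hY : S.markovMeasure μ hμ (S.codingDomain x) = 1) :
    IsEquilibriumState leftShift (S.energy x) (S.markovMeasure μ hμ) ∧
      pressure (X := CodeSpace E) leftShift (S.energy x) = 0 := by
  have hprob := MarkovSystem.isProbabilityMeasure_markovMeasure hμ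
  have hM : S.markovMeasure μ hμ ∈ invariantMeasures leftShift :=
    ⟨hprob, MarkovSystem.measurePreserving_leftShift_markovMeasure hμ⟩
  have hup : ∀ Θ ∈ invariantMeasures (leftShift : CodeSpace E → CodeSpace E),
      ksEntropy leftShift Θ + energyIntegral Θ (S.energy x) ≤ 0 := fun Θ ⟨_, hΘ⟩ =>
    MarkovSystem.ksEntropy_add_energyIntegral_nonpos hx hopen hδ hp
      (fun e => (hunif e).continuousOn) hΘ
  have hlow : 0 ≤ ksEntropy leftShift (S.markovMeasure μ hμ)
      + energyIntegral (S.markovMeasure μ hμ) (S.energy x) :=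
    MarkovSystem.ksEntropy_add_energyIntegral_nonneg hμ hopen ha hunif hδ hp hx
      ((prob_compl_eq_zero_iff MarkovSystem.measurableSet_codingDomain).2 hY)
  have hpress : pressure (X := CodeSpace E) leftShift (S.energy x) = 0 :=
    (iSup₂_le hup).antisymm (hlow.trans (le_iSup₂_of_le _ hM le_rfl))
  have hfin : HasFiniteEntropy (leftShift : CodeSpace E → CodeSpace E) :=
    (iSup₂_le fun Θ ⟨_, hΘ⟩ => ksEntropy_leftShift_le_log_card hΘ).trans_lt (EReal.coe_lt_top _)
  exact ⟨⟨MarkovSystem.isEnergyFunction_energy, hfin, hM,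
    ((hup _ hM).antisymm hlow).trans hpress.symm⟩, hpress⟩

theorem proposition1
    {V E K : Type*} [Fintype V] [Fintype E]
    [TopologicalSpace E] [DiscreteTopology E] [MeasurableSpace E] [BorelSpace E]
    [MetricSpace K] [ProperSpace K] [MeasurableSpace K] [BorelSpace K]
    (S : MarkovSystem V E K)
    (hinit : Function.Surjective S.init)
    (hopen : ∀ v, IsOpen (S.vertexSet v))
    (a : ℝ) (ha : S.IsContractive a)
    (hunif : ∀ e, UniformContinuousOn (S.p e) (S.vertexSet (S.init e)))
    (δ : ℝ) (hδ : 0 < δ) (hp : ∀ e, ∀ y ∈ S.vertexSet (S.init e), δ ≤ S.p e y)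
    (x : V → K) (hx : ∀ v, x v ∈ S.vertexSet v)
    (μ : Measure K) [IsProbabilityMeasure μ] (hμ : S.IsInvariant μ)
    (hmoment : ∃ z : V → K, (∑ v, (∫⁻ y in S.vertexSet v, edist y (z v) ∂μ)) < ⊤)
    (hY : S.markovMeasure μ hμ (S.codingDomain x) = 1) :
    IsEquilibriumState leftShift (S.energy x) (S.markovMeasure μ hμ) ∧
      pressure (X := CodeSpace E) leftShift (S.energy x) = 0 :=
  proposition1_general S hopen a ha hunif δ hδ hp x hx μ hμ hY
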